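/- Let $p$ be a prime and let $R$ be a commutative ring of characteristic $p$ that is F-finite, i.e. finitely generated as a module over its subring $R^p$ of $p$-th powers. Let $T\subseteq R$ be an F-finite regular domain with fraction field $K$ such that $R$ is module-finite over $T$. Let $c\in T\subseteq R$ be a discriminant of $R$ over $T$, that is, $c=\det(\operatorname{trace}(r_ir_j))$, where $r_1,\dots,r_n\in R$ map to a basis of $K\otimes_T R$ over $K$ and the trace is that of $K\otimes_T R$ over $K$. Let $D(R)=D_{\mathbb Z}(R)$ be the ring of $\mathbb Z$-linear (Grothendieck) differential operators on $R$: $D(R)=\bigcup_n D^n(R)$, where $D^0(R)=\operatorname{Hom}_R(R,R)$ and $D^n(R)$ consists of the $\theta\in\operatorname{End}_{\mathbb Z}(R)$ with $[r,\theta]\in D^{n-1}(R)$ for all $r\in R$; it acts on $R$ by evaluation. (1) If $R$ is a domain and the extension of fraction fields $K\subseteq\operatorname{Frac}(R)$ is separable, then $R$ is a simple $D(R)$-module if and only if there is $\theta\in D(R)$ with $\theta(c^2)=1$. (2) Suppose, more generally, that $R$ is reduced (not necessarily a domain), torsion-free as a $T$-module, and generically smooth over $T$ (i.e. $K\otimes_T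 R$ is smooth over $K$). If $R$ is a simple $D(R)$-module, then there is $\theta\in D(R)$ with $\theta(c^2)=1$. Conversely, if there is such a $\theta$ and $R$ has no idempotents other than $0$ and $1$, then $R$ is a simple $D(R)$-module. -/

import Mathlib

open scoped TensorProduct

/-- `IsDiffOp k R n θ`: the `k`-linear endomorphism `θ` of `R` is a differential operator of
order at most `n`, that is, `θ ∈ Dⁿ_k(R, R)`.  Order at most `0` means `R`-linear, and order at
most `n + 1` means that every commutator `[r, θ] = r ∘ θ - θ ∘ r` has order at most `n`. -/
def IsDiffOp (k R : Type*) [CommRing k] [CommRing R] [Algebra k R] :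
    ℕ → Module.End k R → Prop
  | 0, θ => ∀ r x : R, θ (r * x) = r * θ x
  | n + 1, θ => ∀ r : R,
      IsDiffOp k R n (LinearMap.mulLeft k r * θ - θ * LinearMap.mulLeft k r)

namespace IsDiffOp

variable {k R : Type*} [CommRing k] [CommRing R] [Algebra k R]

theorem zero_op (n : ℕ) : IsDiffOp k R n 0 := by
  induction n with
  | zero => intro r x; simp
  | succ n ih => intro r; simpa using ih

theorem succ {n : ℕ} {θ : Module.End k R} (h : IsDiffOp k R n θ) : IsDiffOp k R (n + 1) θ := by
  induction n generalizing θ with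
  | zero =>
    intro r
    have : LinearMap.mulLeft k r * θ - θ * LinearMap.mulLeft k r = 0 := by
      ext x
      simp [h r x]
    rw [this]
    exact zero_op 0
  | succ n ih => intro r; exact ih (h r)

theorem mono {m n : ℕ} (hmn : m ≤ n) {θ : Module.End k R} (h : IsDiffOp k R m θ) :
    IsDiffOp k R n θ := by
  induction hmn with
  | refl => exact h
  | step _ ih => exact ih.succ

theorem add {n : ℕ} {θ φ : Module.End k R} (hθ : IsDiffOp k R n θ) (hφ : IsDiffOp k R n φ) :
    IsDiffOp k R n (θ + φ) := by
  induction n generalizing θ φ with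
  | zero =>
    intro r x
    rw [LinearMap.add_apply, LinearMap.add_apply, hθ r x, hφ r x, mul_add]
  | succ n ih =>
    intro r
    have : LinearMap.mulLeft k r * (θ + φ) - (θ + φ) * LinearMap.mulLeft k r =
        (LinearMap.mulLeft k r * θ - θ * LinearMap.mulLeft k r) +
        (LinearMap.mulLeft k r * φ - φ * LinearMap.mulLeft k r) := by noncomm_ring
    rw [this]
    exact ih (hθ r) (hφ r)

theorem mul {m n : ℕ} {θ φ : Module.End k R} (hθ : IsDiffOp k R m θ) (hφ : IsDiffOp k R n φ) :
    IsDiffOp k R (m + n) (θ * φ) := by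
  induction hN : m + n generalizing m n θ φ with
  | zero =>
    obtain ⟨rfl, rfl⟩ : m = 0 ∧ n = 0 := by omega
    intro r x
    rw [Module.End.mul_apply, Module.End.mul_apply, hφ r x, hθ r]
  | succ N ih =>
    intro r
    have key : LinearMap.mulLeft k r * (θ * φ) - θ * φ * LinearMap.mulLeft k r =
        (LinearMap.mulLeft k r * θ - θ * LinearMap.mulLeft k r) * φ +
        θ * (LinearMap.mulLeft k r * φ - φ * LinearMap.mulLeft k r) := by
      simp only [sub_mul, mul_sub, mul_assoc]
      abel
    rw [key]
    refine IsDiffOp.add ?_ ?_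
    · cases m with
      | zero =>
        have : LinearMap.mulLeft k r * θ - θ * LinearMap.mulLeft k r = 0 := by
          ext x
          simp [hθ r x]
        rw [this, zero_mul]
        exact zero_op N
      | succ m => exact ih (hθ r) hφ (by omega)
    · cases n with
      | zero =>
        have : LinearMap.mulLeft k r * φ - φ * LinearMap.mulLeft k r = 0 := by
          ext x
          simp [hφ r x]
        rw [this, mul_zero]
        exact zero_op N
      | succ n => exact ih hθ (hφ r) (by omega)

end IsDiffOp

/-- The ring `D_k(R)` of `k`-linear differential operators on `R`, as a subalgebra of `End_k(R)`.
It acts on `R` by evaluation. -/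
def diffOpRing (k R : Type*) [CommRing k] [CommRing R] [Algebra k R] :
    Subalgebra k (Module.End k R) where
  carrier := {θ | ∃ n : ℕ, IsDiffOp k R n θ}
  mul_mem' := by
    rintro θ φ ⟨m, hθ⟩ ⟨n, hφ⟩
    exact ⟨m + n, hθ.mul hφ⟩
  add_mem' := by
    rintro θ φ ⟨m, hθ⟩ ⟨n, hφ⟩
    exact ⟨max m n, (hθ.mono (le_max_left m n)).add (hφ.mono (le_max_right m n))⟩
  algebraMap_mem' := by
    intro a
    refine ⟨0, fun r x => ?_⟩
    simp [Module.algebraMap_end_apply]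

/-- A ring of prime characteristic `p` is F-finite if the Frobenius endomorphism `x ↦ x ^ p` is
finite, that is, if it is finitely generated as a module over its subring of `p`-th powers. -/
def IsFFinite (p : ℕ) (R : Type*) [CommRing R] [ExpChar R p] : Prop :=
  (frobenius R p).Finite

/-- `c` is a discriminant of `R` over the domain `T` with fraction field `K`: there are
`r₁, …, rₙ ∈ R` whose images form a basis of `K ⊗[T] R` over `K` such that
`c = det (trace (rᵢ rⱼ))`, the trace being that of `K ⊗[T] R` over `K`. -/
def IsDiscriminant (T R K : Type*) [CommRing T] [CommRing R] [Algebra T R] [Field K]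
    [Algebra T K] (c : T) : Prop :=
  ∃ (n : ℕ) (r : Fin n → R) (b : Module.Basis (Fin n) K (K ⊗[T] R)),
    (∀ i, b i = (1 : K) ⊗ₜ[T] r i) ∧
    algebraMap T K c =
      (Matrix.of fun i j => Algebra.trace K (K ⊗[T] R) ((1 : K) ⊗ₜ[T] (r i * r j))).det

/-! If `R` is simple, the nonzero element c² generates it over D(R); c is nonzero because smoothness
makes the generic trace form nondegenerate.

For the converse, F-finiteness identifies D(R) with the additive endomorphisms that are linear over
some q-th powers, q = p^e (`mem_diffOpRing_iff_of_isFFinite`). Frobenius is flat on `T` by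
regularity, hence projective. This makes `T` strongly F-regular: every t ≠ 0 is sent to 1 by some ρ
with ρ(a^q x) = aρ(x) (`exists_isCartierLinear_eq_one`). In particular `T` is normal, so the generic
trace maps `R` to `T`. Trace commutes with Frobenius, and bases dual for the trace form have common
denominator c. Thus cρ extends to a Cartier linear map σ on `R`
(`TraceDual.isCartierLinear_extend`), and D(R) carries t to σ(t)^q = c^q.

It remains to carry every power of c to 1. If θ(c^(N+1)) = 1 and σ extends c times a Frobenius
splitting, then θ, σ, θ move c^(Nq+N+1) through c^(Nq) and c^(N+1) to 1. For N ≥ 1 the exponent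
increases, so induction can start at c² (`exists_mem_diffOpRing_pow_succ_eq_one`).

Hence every nonzero t in `T` is carried to 1. Given x ≠ 0 in `R`, the reduced Artinian ring K ⊗ R
contains an idempotent generating the same ideal as x. An operator carrying a denominator to 1
forces this idempotent into `R`. It must then be 1, so x has a nonzero multiple in `T`, which is
carried to 1. -/

/-! ### Regular sequences in regular local rings -/

section RegularSequences

open RingTheory.Sequence IsLocalRing
open scoped Pointwise

universe u v

/-- Weak regularity of a sequence passes to extensions of modules. -/
theorem isWeaklyRegular_of_exact {R : Type u} [CommRing R] (rs : List R)
    {M M' M'' : Type v} [AddCommGroup M] [AddCommGroup M'] [AddCommGroup M'']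
    [Module R M] [Module R M'] [Module R M'']
    {f : M →ₗ[R] M'} {g : M' →ₗ[R] M''} (hf : Function.Injective f)
    (hfg : Function.Exact f g) (hg : Function.Surjective g)
    (h : IsWeaklyRegular M rs) (h'' : IsWeaklyRegular M'' rs) : IsWeaklyRegular M' rs := by
  induction rs generalizing M M' M'' with
  | nil => exact .nil R M'
  | cons r rs ih =>
    rw [isWeaklyRegular_cons_iff] at h h'' ⊢
    refine ⟨isSMulRegular_of_range_eq_ker hf (LinearMap.exact_iff.mp hfg).symm h.1 h''.1, ?_⟩
    refine ih (f := QuotSMulTop.map r f) (g := QuotSMulTop.map r g) ?_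
      (QuotSMulTop.map_exact r hfg hg) (QuotSMulTop.map_surjective r hg) h.2 h''.2
    -- Regularity of `r` on the quotient module kills the Tor obstruction, so reduction modulo `r`
    -- stays exact on the left.
    have h0 : Function.Exact (0 : PUnit →ₗ[R] M) f := by
      rw [LinearMap.exact_zero_iff_injective]; exact hf
    have := QuotSMulTop.map_first_exact_on_four_term_exact_of_isSMulRegular_last h0 hfg h''.1
    rw [map_zero] at this
    exact (LinearMap.exact_zero_iff_injective _ _).mp this

/-- Induction along 0 → M/xⁿ⁺¹ → M/xⁿ⁺² → M/x → 0, whose first map is multiplication by x: the tail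
of the sequence is regular on both ends. -/
theorem isWeaklyRegular_pow_cons {R : Type u} [CommRing R] {M : Type v} [AddCommGroup M]
    [Module R M] {x : R} {rs : List R} (h : IsWeaklyRegular M (x :: rs)) (n : ℕ) :
    IsWeaklyRegular M (x ^ (n + 1) :: rs) := by
  induction n with
  | zero => simpa using h
  | succ n ih =>
    rw [isWeaklyRegular_cons_iff] at h ih ⊢
    refine ⟨h.1.pow _, ?_⟩
    have hmem : ∀ (k : ℕ) (m : M), m ∈ (x ^ k • (⊤ : Submodule R M)) ↔ ∃ y, x ^ k • y = m := by
      intro k m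
      rw [Submodule.mem_smul_pointwise_iff_exists]
      simp
    let f : QuotSMulTop (x ^ (n + 1)) M →ₗ[R] QuotSMulTop (x ^ (n + 1 + 1)) M :=
      Submodule.mapQ _ _ (LinearMap.lsmul R M x) (by
        intro m hm
        obtain ⟨y, rfl⟩ := (hmem _ _).1 hm
        refine (hmem _ _).2 ⟨y, ?_⟩
        simp only [LinearMap.lsmul_apply, smul_smul, ← pow_succ'])
    let g : QuotSMulTop (x ^ (n + 1 + 1)) M →ₗ[R] QuotSMulTop x M :=
      Submodule.mapQ _ _ LinearMap.id (by
        intro m hm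
        obtain ⟨y, rfl⟩ := (hmem _ _).1 hm
        have := (hmem 1 (x ^ (n + 1 + 1) • y)).2
          ⟨x ^ (n + 1) • y, by rw [pow_one, smul_smul, ← pow_succ']⟩
        simpa using this)
    refine isWeaklyRegular_of_exact rs (f := f) (g := g) ?_ ?_ ?_ ih.2 h.2
    · rw [injective_iff_map_eq_zero]
      intro a ha
      obtain ⟨m, rfl⟩ := Submodule.mkQ_surjective _ a
      have ha' : x • m ∈ (x ^ (n + 1 + 1) • (⊤ : Submodule R M)) :=
        (Submodule.Quotient.mk_eq_zero _).1 ha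
      obtain ⟨y, hy⟩ := (hmem _ _).1 ha'
      refine (Submodule.Quotient.mk_eq_zero _).2 ((hmem _ _).2 ⟨y, h.1 ?_⟩)
      simp only [smul_smul, ← pow_succ']
      exact hy
    · intro a
      obtain ⟨m, rfl⟩ := Submodule.mkQ_surjective _ a
      constructor
      · intro ha
        have ha' : m ∈ (x • (⊤ : Submodule R M)) := (Submodule.Quotient.mk_eq_zero _).1 ha
        obtain ⟨y, hy⟩ := (hmem 1 m).1 (by simpa using ha')
        exact ⟨Submodule.Quotient.mk y, by rw [← hy, pow_one]; rfl⟩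
      · rintro ⟨b, hb⟩
        obtain ⟨y, rfl⟩ := Submodule.mkQ_surjective _ b
        rw [← hb]
        refine (Submodule.Quotient.mk_eq_zero _).2 ?_
        have := (hmem 1 (x • y)).2 ⟨y, by rw [pow_one]⟩
        simpa using this
    · intro a
      obtain ⟨m, rfl⟩ := Submodule.mkQ_surjective _ a
      exact ⟨Submodule.Quotient.mk m, rfl⟩

theorem isWeaklyRegular_map_pow {R : Type u} [CommRing R] {rs : List R} {M : Type v}
    [AddCommGroup M] [Module R M] (h : IsWeaklyRegular M rs) (n : ℕ) :
    IsWeaklyRegular M (rs.map (· ^ (n + 1))) := by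
  induction rs generalizing M with
  | nil => exact .nil R M
  | cons x rs ih =>
    rw [isWeaklyRegular_cons_iff] at h
    exact isWeaklyRegular_pow_cons ((isWeaklyRegular_cons_iff M x _).2 ⟨h.1, ih h.2⟩) n

theorem map_quotientMk_maximalIdeal {S : Type u} [CommRing S] [IsLocalRing S] {I : Ideal S}
    [IsLocalRing (S ⧸ I)] (hle : I ≤ maximalIdeal S) :
    (maximalIdeal S).map (Ideal.Quotient.mk I) = maximalIdeal (S ⧸ I) := by
  refine eq_maximalIdeal ?_
  refine (Ideal.map_eq_top_or_isMaximal_of_surjective _ Ideal.Quotient.mk_surjective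
    (maximalIdeal.isMaximal S)).resolve_left fun h => ?_
  have := Ideal.comap_map_of_surjective' (Ideal.Quotient.mk (I))
    Ideal.Quotient.mk_surjective (maximalIdeal S)
  rw [h, Ideal.comap_top, Ideal.mk_ker, sup_eq_left.2 hle] at this
  exact (maximalIdeal.isMaximal S).ne_top this.symm

/-- A finite module over a Noetherian local ring on which some generating sequence of the maximal
ideal is regular is free. -/
theorem Module.free_of_isWeaklyRegular_of_ofList_eq_maximalIdeal {S : Type u} [CommRing S]
    [IsLocalRing S] [IsNoetherianRing S] {rs : List S} (hrs : Ideal.ofList rs = maximalIdeal S)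
    {M : Type v} [AddCommGroup M] [Module S M] [Module.Finite S M] (h : IsWeaklyRegular M rs) :
    Module.Free S M := by
  induction hn : rs.length generalizing S M with
  | zero =>
    obtain rfl := List.length_eq_zero_iff.1 hn
    rw [Ideal.ofList_nil] at hrs
    let := ((isField_iff_maximalIdeal_eq (R := S)).2 hrs.symm).toField
    exact Module.Free.of_divisionRing S M
  | succ n ih =>
    obtain ⟨x, rs, rfl⟩ := List.exists_cons_of_length_eq_add_one hn
    have hx : x ∈ maximalIdeal S := by
      rw [← hrs]; exact Ideal.subset_span (by simp)
    rw [isWeaklyRegular_cons_iff'] at h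
    have hle : Ideal.span {x} ≤ maximalIdeal S := by
      rwa [Ideal.span_singleton_le_iff_mem]
    have : Nontrivial (S ⧸ Ideal.span {x}) :=
      Ideal.Quotient.nontrivial_iff.2 fun h => (maximalIdeal.isMaximal S).ne_top
        (top_le_iff.1 (h ▸ hle))
    have : IsLocalRing (S ⧸ Ideal.span {x}) :=
      .of_surjective' (Ideal.Quotient.mk _) Ideal.Quotient.mk_surjective
    have := Module.Finite.of_restrictScalars_finite S (S ⧸ Ideal.span {x}) (QuotSMulTop x M)
    have hx' : x ∈ (⊥ : Ideal S).jacobson := maximalIdeal_le_jacobson _ hx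
    have := Module.finitePresentation_of_finite S M
    rw [← Module.free_quotSMulTop_iff_free S M hx' h.1]
    refine ih (rs := rs.map (Ideal.Quotient.mk (Ideal.span {x}))) ?_ h.2 (by simpa using hn)
    rw [← Ideal.map_ofList]
    have h1 : (Ideal.ofList (x :: rs)).map (Ideal.Quotient.mk (Ideal.span {x})) =
        (Ideal.ofList rs).map (Ideal.Quotient.mk (Ideal.span {x})) := by
      rw [Ideal.ofList_cons, Ideal.map_sup, Ideal.map_quotient_self, bot_sup_eq]
    rw [← h1, hrs, map_quotientMk_maximalIdeal hle]

/-- Prime avoidance, which tolerates the non-prime ideal 𝔪². If 𝔪 = 𝔪², Nakayama gives 𝔪 = 0,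
contradicting positive dimension. -/
theorem exists_mem_maximalIdeal_notMem_sq_notMem_minimalPrimes {S : Type u} [CommRing S]
    [IsLocalRing S] [IsNoetherianRing S] (hd : 0 < ringKrullDim S) :
    ∃ x ∈ maximalIdeal S, x ∉ maximalIdeal S ^ 2 ∧ ∀ P ∈ minimalPrimes S, x ∉ P := by
  by_contra! H
  have hsub : (maximalIdeal S : Set S) ⊆
      ⋃ I ∈ insert (maximalIdeal S ^ 2) (minimalPrimes S), (I : Set S) := by
    intro x hx
    by_cases h2 : x ∈ maximalIdeal S ^ 2
    · exact Set.mem_biUnion (Set.mem_insert _ _) h2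
    · obtain ⟨P, hP, hxP⟩ := H x hx h2
      exact Set.mem_biUnion (Set.mem_insert_of_mem _ hP) hxP
  have hfin : (insert (maximalIdeal S ^ 2) (minimalPrimes S)).Finite :=
    ((⊥ : Ideal S).finite_minimalPrimes_of_isNoetherianRing).insert _
  rw [Ideal.subset_union_prime_finite (f := fun I => I) hfin (maximalIdeal S ^ 2)
    (maximalIdeal S ^ 2) (fun i hi h _ => (hi.resolve_left h).1.1)] at hsub
  rw [← maximalIdeal_height_eq_ringKrullDim] at hd
  have hd' : (maximalIdeal S).height ≠ 0 := by
    intro h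
    rw [h] at hd
    simp at hd
  have hmin : maximalIdeal S ∉ minimalPrimes S := fun h => hd' (Ideal.height_eq_zero_iff.2 h)
  obtain ⟨I, hI, hle⟩ := hsub
  rcases hI with rfl | hI
  · have hbot : maximalIdeal S = ⊥ := by
      refine Submodule.eq_bot_of_le_smul_of_le_jacobson_bot (maximalIdeal S) _
        (IsNoetherian.noetherian _) ?_ (maximalIdeal_le_jacobson _)
      rwa [smul_eq_mul, ← sq]
    refine hmin ?_
    refine ⟨⟨inferInstance, bot_le⟩, fun J _ _ => ?_⟩
    rw [hbot]; exact bot_le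
  · have : maximalIdeal S = I :=
      (maximalIdeal.isMaximal S).eq_of_le hI.1.1.ne_top hle
    exact hmin (this ▸ hI)

/-- A family generating the maximal ideal of a local ring can be shortened modulo any element
outside the square of the maximal ideal. -/
theorem exists_span_sup_eq_of_notMem_sq {S : Type u} [CommRing S] [IsLocalRing S] {n : ℕ}
    {y : Fin (n + 1) → S} (hy : Ideal.span (Set.range y) = maximalIdeal S) {x : S}
    (hx : x ∈ maximalIdeal S) (hx2 : x ∉ maximalIdeal S ^ 2) :
    ∃ z : Fin n → S, Ideal.span {x} ⊔ Ideal.span (Set.range z) = maximalIdeal S := by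
  have hym : ∀ i, y i ∈ maximalIdeal S := fun i => hy ▸ Ideal.subset_span ⟨i, rfl⟩
  rw [← hy, Ideal.mem_span_range_iff_exists_fun] at hx
  obtain ⟨a, ha⟩ := hx
  obtain ⟨i, hi⟩ : ∃ i, IsUnit (a i) := by
    by_contra! H
    refine hx2 (ha ▸ Ideal.sum_mem _ fun i _ => ?_)
    rw [sq]
    exact Ideal.mul_mem_mul ((mem_maximalIdeal _).2 (H i)) (hym i)
  refine ⟨fun j => y (i.succAbove j), le_antisymm ?_ ?_⟩
  · refine sup_le ?_ ?_
    · rw [Ideal.span_singleton_le_iff_mem, ← ha]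
      exact Ideal.sum_mem _ fun i _ => Ideal.mul_mem_left _ _ (hym i)
    · rw [Ideal.span_le]
      rintro _ ⟨j, rfl⟩
      exact hym _
  · rw [← hy, Ideal.span_le]
    have hz : ∀ j, y (i.succAbove j) ∈
        Ideal.span {x} ⊔ Ideal.span (Set.range fun j => y (i.succAbove j)) := fun j =>
      Ideal.mem_sup_right (Ideal.subset_span ⟨j, rfl⟩)
    rintro _ ⟨k, rfl⟩
    rcases Fin.eq_self_or_eq_succAbove i k with rfl | ⟨j, rfl⟩
    · rw [Fin.sum_univ_succAbove _ k] at ha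
      have h1 : a k * y k ∈
          Ideal.span {x} ⊔ Ideal.span (Set.range fun j => y (k.succAbove j)) := by
        rw [← eq_sub_iff_add_eq] at ha
        rw [ha]
        exact Ideal.sub_mem _ (Ideal.mem_sup_left (Ideal.mem_span_singleton_self x))
          (Ideal.sum_mem _ fun j _ => Ideal.mul_mem_left _ _ (hz j))
      exact (Ideal.unit_mul_mem_iff_mem _ hi).1 h1
    · exact hz j

/-- Cutting by x outside 𝔪² and the minimal primes lowers both the number of generators and the
dimension by one. The domain property is carried through the induction because it makes the next x
regular. -/
theorem isDomain_and_exists_isWeaklyRegular_of_span_eq_maximalIdeal (n : ℕ) {S : Type u}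
    [CommRing S] [IsLocalRing S] [IsNoetherianRing S] (y : Fin n → S)
    (hy : Ideal.span (Set.range y) = maximalIdeal S) (hn : n ≤ ringKrullDim S) :
    IsDomain S ∧ ∃ rs : List S, Ideal.ofList rs = maximalIdeal S ∧ IsWeaklyRegular S rs := by
  induction n generalizing S with
  | zero =>
    have hbot : maximalIdeal S = ⊥ := by rw [← hy]; simp
    refine ⟨((isField_iff_maximalIdeal_eq (R := S)).2 hbot).isDomain, [], ?_, .nil S S⟩
    rw [hbot, Ideal.ofList_nil]
  | succ n ih =>
    obtain ⟨x, hx, hx2, hxP⟩ := exists_mem_maximalIdeal_notMem_sq_notMem_minimalPrimes (S := S)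
      (lt_of_lt_of_le (by exact_mod_cast n.succ_pos) hn)
    obtain ⟨z, hz⟩ := exists_span_sup_eq_of_notMem_sq hy hx hx2
    have hle : Ideal.span {x} ≤ maximalIdeal S := by
      rwa [Ideal.span_singleton_le_iff_mem]
    have : Nontrivial (S ⧸ Ideal.span {x}) :=
      Ideal.Quotient.nontrivial_iff.2 fun h => (maximalIdeal.isMaximal S).ne_top
        (top_le_iff.1 (h ▸ hle))
    have : IsLocalRing (S ⧸ Ideal.span {x}) :=
      .of_surjective' (Ideal.Quotient.mk _) Ideal.Quotient.mk_surjective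
    have hmax : (maximalIdeal S).map (Ideal.Quotient.mk (Ideal.span {x})) =
        maximalIdeal (S ⧸ Ideal.span {x}) := map_quotientMk_maximalIdeal hle
    have hdim : (n : WithBot ℕ∞) ≤ ringKrullDim (S ⧸ Ideal.span {x}) := by
      have h1 := Ideal.height_le_ringKrullDim_quotient_add_one hx
      rw [maximalIdeal_height_eq_ringKrullDim] at h1
      have h2 := hn.trans h1
      push_cast at h2
      by_contra! h3
      exact absurd ((ENat.WithBot.add_one_le_iff.1 h2).trans_le
        (ENat.WithBot.add_one_le_natCast_iff.2 h3)) (lt_irrefl _)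
    obtain ⟨hdom, rs, hrs, hreg⟩ := ih (fun i => Ideal.Quotient.mk (Ideal.span {x}) (z i)) (by
      rw [← hmax, ← hz, Ideal.map_sup, Ideal.map_quotient_self, bot_sup_eq, Ideal.map_span,
        ← Set.range_comp]
      rfl) hdim
    have hprime : (Ideal.span {x}).IsPrime := (Ideal.Quotient.isDomain_iff_prime _).1 hdom
    have hSdom : IsDomain S := by
      obtain ⟨P, hP, hPx⟩ := Ideal.exists_minimalPrimes_le (bot_le : (⊥ : Ideal S) ≤ Ideal.span {x})
      -- Since P ⊆ (x) and x ∉ P, P = xP, so Nakayama applies.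
      have hPbot : P = ⊥ := by
        refine Submodule.eq_bot_of_le_smul_of_le_jacobson_bot (Ideal.span {x}) _
          (IsNoetherian.noetherian _) ?_ (hle.trans (maximalIdeal_le_jacobson _))
        intro a ha
        obtain ⟨b, rfl⟩ := Ideal.mem_span_singleton.1 (hPx ha)
        rw [smul_eq_mul]
        exact Ideal.mul_mem_mul (Ideal.mem_span_singleton_self x)
          ((hP.1.1.mem_or_mem ha).resolve_left (hxP P hP))
      have : (⊥ : Ideal S).IsPrime := by rw [← hPbot]; exact hP.1.1
      exact IsDomain.of_bot_isPrime S
    have hx0 : x ≠ 0 := by rintro rfl; exact hx2 (zero_mem _)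
    obtain ⟨rs', rfl⟩ : ∃ rs' : List S, rs'.map (Ideal.Quotient.mk (Ideal.span {x})) = rs :=
      List.map_surjective_iff.2 Ideal.Quotient.mk_surjective rs
    refine ⟨hSdom, x :: rs', ?_, ?_⟩
    · rw [← Ideal.map_ofList, ← hmax] at hrs
      have := congrArg (Ideal.comap (Ideal.Quotient.mk (Ideal.span {x}))) hrs
      rw [Ideal.comap_map_of_surjective' _ Ideal.Quotient.mk_surjective,
        Ideal.comap_map_of_surjective' _ Ideal.Quotient.mk_surjective, Ideal.mk_ker,
        sup_eq_left.2 hle] at this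
      rw [Ideal.ofList_cons, sup_comm, this]
    · rw [isWeaklyRegular_cons_iff']
      refine ⟨IsSMulRegular.of_ne_zero hx0, ?_⟩
      have e : QuotSMulTop x S ≃ₗ[S ⧸ Ideal.span {x}] (S ⧸ Ideal.span {x}) := by
        refine LinearEquiv.extendScalarsOfSurjective (R := S) Ideal.Quotient.mk_surjective ?_
        exact Submodule.quotEquivOfEq _ _ (by simp [← Submodule.ideal_span_singleton_smul])
      exact (LinearEquiv.isWeaklyRegular_congr e _).2 hreg

theorem IsRegularLocalRing.exists_isWeaklyRegular (S : Type u) [CommRing S]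
    [IsRegularLocalRing S] :
    ∃ rs : List S, Ideal.ofList rs = maximalIdeal S ∧ IsWeaklyRegular S rs := by
  have hfg : (maximalIdeal S).FG := IsNoetherian.noetherian _
  have hcard := Submodule.FG.generators_ncard hfg
  have hfin := Submodule.FG.finite_generators hfg
  have hsp : Ideal.span (maximalIdeal S).generators = maximalIdeal S :=
    (maximalIdeal S).span_generators
  obtain ⟨y, hy⟩ : ∃ y : Fin (maximalIdeal S).spanFinrank → S,
      Set.range y = (maximalIdeal S).generators := by
    have := hfin.fintype
    have hc : Fintype.card (maximalIdeal S).generators = (maximalIdeal S).spanFinrank := by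
      rw [← hcard, Set.ncard_eq_toFinset_card', Set.toFinset_card]
    refine ⟨fun i => ((Fintype.equivFinOfCardEq hc).symm i : S), ?_⟩
    have := (Fintype.equivFinOfCardEq hc).symm.surjective.range_comp
      (Subtype.val : (maximalIdeal S).generators → S)
    exact this.trans Subtype.range_coe
  exact (isDomain_and_exists_isWeaklyRegular_of_span_eq_maximalIdeal _ y (by rw [hy, hsp])
    (IsRegularLocalRing.spanFinrank_maximalIdeal (R := S)).le).2

end RegularSequences

/-! ### Flatness of Frobenius on regular rings -/

section FrobeniusTwist

open RingTheory.Sequence IsLocalRing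

universe u v

/-- The ring `S` regarded as an algebra over itself, and over the rings over which `S` is an
algebra, through the Frobenius endomorphism. -/
def FrobeniusTwist (p : ℕ) (S : Type u) [CommRing S] [ExpChar S p] : Type u := S

namespace FrobeniusTwist

variable (p : ℕ) (S : Type u) [CommRing S] [ExpChar S p]

instance : CommRing (FrobeniusTwist p S) := inferInstanceAs (CommRing S)

instance {A : Type v} [CommRing A] [Algebra A S] : Algebra A (FrobeniusTwist p S) :=
  ((frobenius S p).comp (algebraMap A S)).toAlgebra

instance {A : Type v} [CommRing A] [Algebra A S] : IsScalarTower A S (FrobeniusTwist p S) :=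
  IsScalarTower.of_algebraMap_eq fun _ => rfl

/-- The identity of `S`, as a ring isomorphism onto its Frobenius twist. -/
def equiv : S ≃+* FrobeniusTwist p S := RingEquiv.refl S

variable {S}

theorem smul_equiv {A : Type v} [CommRing A] [Algebra A S] (a : A) (x : S) :
    a • equiv p S x = equiv p S (algebraMap A S a ^ p * x) := by
  rw [Algebra.smul_def]; rfl

end FrobeniusTwist

open FrobeniusTwist

/-- The Frobenius endomorphism of an F-finite regular local ring is free. -/
theorem FrobeniusTwist.free_of_isRegularLocalRing (p : ℕ) [Fact p.Prime] (S : Type u) [CommRing S]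
    [ExpChar S p] [IsRegularLocalRing S] [Module.Finite S (FrobeniusTwist p S)] :
    Module.Free S (FrobeniusTwist p S) := by
  obtain ⟨rs, hrs, hreg⟩ := IsRegularLocalRing.exists_isWeaklyRegular S
  refine Module.free_of_isWeaklyRegular_of_ofList_eq_maximalIdeal hrs ?_
  obtain ⟨k, hk⟩ : ∃ k, p = k + 1 := ⟨p - 1, by have := (Fact.out : p.Prime).pos; omega⟩
  -- On the twist, each generator acts as multiplication by its p-th power.
  have h := isWeaklyRegular_map_pow hreg k
  refine (AddEquiv.isWeaklyRegular_congr (e := (equiv p S).toAddEquiv) ?_).1 h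
  rw [List.forall₂_map_left_iff]
  refine List.forall₂_same.2 fun r _ x => ?_
  change equiv p S (r ^ (k + 1) * x) = r • equiv p S x
  rw [smul_equiv, Algebra.algebraMap_self, RingHom.id_apply, ← hk]

/-- The Frobenius endomorphism commutes with localization. -/
theorem FrobeniusTwist.exists_isLocalizedModule (p : ℕ) [hp : Fact p.Prime] (T S : Type u)
    [CommRing T] [ExpChar T p] [CommRing S] [ExpChar S p] [Algebra T S] (M : Submonoid T)
    [IsLocalization M S] :
    ∃ f : FrobeniusTwist p T →ₗ[T] FrobeniusTwist p S, IsLocalizedModule M f := by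
  let f : FrobeniusTwist p T →ₗ[T] FrobeniusTwist p S :=
    { toFun := fun x => equiv p S (algebraMap T S ((equiv p T).symm x))
      map_add' := fun x y => by simp
      map_smul' := fun a x => by
        obtain ⟨x, rfl⟩ := (equiv p T).surjective x
        rw [smul_equiv, RingEquiv.symm_apply_apply, RingHom.id_apply, RingEquiv.symm_apply_apply,
          smul_equiv]
        simp }
  have hf : ∀ x, f (equiv p T x) = equiv p S (algebraMap T S x) := fun x => by simp [f]
  refine ⟨f, ⟨?_, ?_, ?_⟩⟩
  · intro m
    rw [Module.End.isUnit_iff]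
    have hu : IsUnit (algebraMap T S m ^ p) := (IsLocalization.map_units S m).pow p
    have hact : ∀ x : S, (algebraMap T (Module.End T (FrobeniusTwist p S)) m) (equiv p S x) =
        equiv p S (algebraMap T S m ^ p * x) := fun x => by
      rw [Module.algebraMap_end_apply, smul_equiv]
    constructor
    · intro x y hxy
      obtain ⟨x, rfl⟩ := (equiv p S).surjective x
      obtain ⟨y, rfl⟩ := (equiv p S).surjective y
      rw [hact, hact] at hxy
      rw [hu.mul_left_cancel ((equiv p S).injective hxy)]
    · intro y
      obtain ⟨y, rfl⟩ := (equiv p S).surjective y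
      obtain ⟨u, hu⟩ := hu
      exact ⟨equiv p S (↑u⁻¹ * y), by rw [hact, ← hu, Units.mul_inv_cancel_left]⟩
  · intro y
    obtain ⟨y, rfl⟩ := (equiv p S).surjective y
    obtain ⟨⟨a, m⟩, h⟩ := IsLocalization.surj M y
    -- With y = a/m, the twisted action of m gives m^p y = m^(p-1) a.
    refine ⟨⟨equiv p T (m ^ (p - 1) * a), m⟩, ?_⟩
    change (m : T) • equiv p S y = f (equiv p T _)
    have h' : y * algebraMap T S m = algebraMap T S a := h
    rw [smul_equiv, hf]
    congr 1
    rw [map_mul, map_pow, ← h', mul_comm y, ← mul_assoc, pow_sub_one_mul hp.out.ne_zero]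
  · intro x y hxy
    obtain ⟨x, rfl⟩ := (equiv p T).surjective x
    obtain ⟨y, rfl⟩ := (equiv p T).surjective y
    rw [hf, hf] at hxy
    obtain ⟨m, hm⟩ := IsLocalization.exists_of_eq (M := M) ((equiv p S).injective hxy)
    refine ⟨m, ?_⟩
    change (m : T) • equiv p T x = (m : T) • equiv p T y
    rw [smul_equiv, smul_equiv]
    congr 1
    simp only [Algebra.algebraMap_self, RingHom.id_apply]
    rw [← pow_sub_one_mul hp.out.ne_zero, mul_assoc, hm, ← mul_assoc]

theorem IsFFinite.finite_frobeniusTwist {p : ℕ} {T : Type u} [CommRing T] [ExpChar T p]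
    (hT : IsFFinite p T) : Module.Finite T (FrobeniusTwist p T) := hT

/-- The Frobenius endomorphism of an F-finite regular domain is projective. -/
theorem FrobeniusTwist.projective_of_isRegularRing (p : ℕ) [hp : Fact p.Prime] (T : Type u)
    [CommRing T] [IsDomain T] [CharP T p] [IsRegularRing T] (hT : IsFFinite p T) :
    Module.Projective T (FrobeniusTwist p T) := by
  have hfin : Module.Finite T (FrobeniusTwist p T) := hT.finite_frobeniusTwist
  have hchar (P : Ideal T) [P.IsPrime] : CharP (Localization.AtPrime P) p :=
    charP_of_injective_algebraMap
      (IsLocalization.injective (Localization.AtPrime P) P.primeCompl_le_nonZeroDivisors) p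
  choose f hf using fun (P : Ideal T) [P.IsMaximal] =>
    FrobeniusTwist.exists_isLocalizedModule p T (Localization.AtPrime P) P.primeCompl
  have : Module.Flat T (FrobeniusTwist p T) := by
    refine Module.flat_of_isLocalized_maximal (R := T) T (FrobeniusTwist p T)
      (fun P _ => FrobeniusTwist p (Localization.AtPrime P)) f fun P hP => ?_
    have : Module.Finite (Localization.AtPrime P) (FrobeniusTwist p (Localization.AtPrime P)) :=
      Module.Finite.of_isLocalizedModule P.primeCompl (f P)
    have := FrobeniusTwist.free_of_isRegularLocalRing p (Localization.AtPrime P)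
    have : Module.Flat T (Localization.AtPrime P) := IsLocalization.flat _ P.primeCompl
    exact Module.Flat.trans T (Localization.AtPrime P) _
  have := Module.finitePresentation_of_finite T (FrobeniusTwist p T)
  exact Module.Flat.projective_of_finitePresentation

end FrobeniusTwist

/-! ### Cartier linear maps and strong F-regularity -/

section CartierLinear

universe u

/-- `ρ` is additive and `ρ (a ^ q * x) = a * ρ x`. -/
def IsCartierLinear {T : Type u} [CommRing T] (q : ℕ) (ρ : T →+ T) : Prop :=
  ∀ a x, ρ (a ^ q * x) = a * ρ x

theorem IsCartierLinear.comp {T : Type u} [CommRing T] {q q' : ℕ} {ρ σ : T →+ T}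
    (hρ : IsCartierLinear q ρ) (hσ : IsCartierLinear q' σ) :
    IsCartierLinear (q * q') (ρ.comp σ) := fun a x => by
  rw [AddMonoidHom.comp_apply, pow_mul, hσ, hρ]; rfl

theorem IsCartierLinear.comp_mulLeft {T : Type u} [CommRing T] {q : ℕ} {ρ : T →+ T}
    (hρ : IsCartierLinear q ρ) (b : T) :
    IsCartierLinear q (ρ.comp (AddMonoidHom.mulLeft b)) := fun a x => by
  simp only [AddMonoidHom.comp_apply, AddMonoidHom.coe_mulLeft]
  rw [mul_left_comm, hρ]

variable (p : ℕ) [hp : Fact p.Prime] {T : Type u} [CommRing T] [IsDomain T] [CharP T p]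
  [IsRegularRing T]

include hp in
-- A dual basis for the finite projective Frobenius module gives exponent p; substituting the
-- expansion into its own coefficients raises it to any p^e.
theorem exists_isCartierLinear_dual (hT : IsFFinite p T) (e : ℕ) :
    ∃ (n : ℕ) (u : Fin n → T) (ρ : Fin n → T →+ T), (∀ i, IsCartierLinear (p ^ e) (ρ i)) ∧
      ∀ x, x = ∑ i, ρ i x ^ p ^ e * u i := by
  have key : ∃ (n : ℕ) (u : Fin n → T) (ρ : Fin n → T →+ T), (∀ i, IsCartierLinear p (ρ i)) ∧
      ∀ x, x = ∑ i, ρ i x ^ p * u i := by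
    have hfin : Module.Finite T (FrobeniusTwist p T) := hT.finite_frobeniusTwist
    have := FrobeniusTwist.projective_of_isRegularRing p T hT
    obtain ⟨n, g, h, hg, -, hgh⟩ := Module.Finite.exists_comp_eq_id_of_projective T
      (FrobeniusTwist p T)
    let E := FrobeniusTwist.equiv p T
    refine ⟨n, fun i => E.symm (g (Pi.single i 1)), fun i =>
      { toFun := fun x => h (E x) i, map_zero' := by simp, map_add' := fun x y => by simp },
      fun i a x => ?_, fun x => ?_⟩
    · change h (E (a ^ p * x)) i = a * h (E x) i
      rw [← smul_eq_mul a, ← Pi.smul_apply, ← map_smul, FrobeniusTwist.smul_equiv]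
      rfl
    · have h1 : g (h (E x)) = E x := LinearMap.congr_fun hgh (E x)
      have h2 : h (E x) = ∑ i, h (E x) i • Pi.single i (1 : T) := by
        conv_lhs => rw [← (Pi.basisFun T (Fin n)).sum_repr (h (E x))]
        simp
      rw [h2, map_sum] at h1
      apply E.injective
      rw [← h1, map_sum]
      refine Finset.sum_congr rfl fun i _ => ?_
      rw [map_smul]
      obtain ⟨y, hy⟩ := E.surjective (g (Pi.single i 1))
      change h (E x) i • g (Pi.single i 1) = E (h (E x) i ^ p * E.symm (g (Pi.single i 1)))
      rw [← hy, RingEquiv.symm_apply_apply]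
      exact FrobeniusTwist.smul_equiv p _ y
  induction e with
  | zero =>
    refine ⟨1, fun _ => 1, fun _ => AddMonoidHom.id T, fun i a x => by simp, fun x => by simp⟩
  | succ e ih =>
    obtain ⟨n, u, ρ, hρ, hu⟩ := key
    obtain ⟨m, v, σ, hσ, hv⟩ := ih
    refine ⟨n * m, fun k => v (finProdFinEquiv.symm k).2 ^ p * u (finProdFinEquiv.symm k).1,
      fun k => (σ (finProdFinEquiv.symm k).2).comp (ρ (finProdFinEquiv.symm k).1),
      fun k => ?_, fun x => ?_⟩
    · rw [pow_succ]; exact (hσ _).comp (hρ _)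
    · rw [← finProdFinEquiv.sum_comp, Fintype.sum_prod_type]
      simp only [Equiv.symm_apply_apply, AddMonoidHom.comp_apply]
      conv_lhs => rw [hu x]
      refine Finset.sum_congr rfl fun i _ => ?_
      conv_lhs => rw [hv (ρ i x)]
      rw [sum_pow_char, Finset.sum_mul]
      refine Finset.sum_congr rfl fun j _ => ?_
      rw [mul_pow, ← pow_mul, ← pow_succ, mul_assoc]

omit [IsDomain T] [CharP T p] [IsRegularRing T] in
theorem IsCartierLinear.mulLeft_comp {q : ℕ} {ρ : T →+ T} (hρ : IsCartierLinear q ρ) (b : T) :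
    IsCartierLinear q ((AddMonoidHom.mulLeft b).comp ρ) := fun a x => by
  simp only [AddMonoidHom.comp_apply, AddMonoidHom.coe_mulLeft]
  rw [hρ, mul_left_comm]

/-- The ideal of values at `t` of the maps `ρ` with `ρ (a ^ q * x) = a * ρ x`. -/
def cartierIdeal (q : ℕ) (t : T) : Ideal T where
  carrier := {x | ∃ ρ : T →+ T, IsCartierLinear q ρ ∧ ρ t = x}
  zero_mem' := ⟨0, fun _ _ => by simp, rfl⟩
  add_mem' := by
    rintro _ _ ⟨ρ, hρ, rfl⟩ ⟨σ, hσ, rfl⟩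
    exact ⟨ρ + σ, fun a x => by simp [hρ a x, hσ a x, mul_add], rfl⟩
  smul_mem' := by
    rintro b _ ⟨ρ, hρ, rfl⟩
    exact ⟨_, hρ.mulLeft_comp b, rfl⟩

include hp in
-- If all dual coordinates of t lay in P, then t = Σ ρᵢ(t)^q uᵢ would lie in P^q.
theorem exists_mem_cartierIdeal_notMem (hT : IsFFinite p T) (e : ℕ) {t : T} {P : Ideal T}
    (ht : t ∉ P ^ p ^ e) : ∃ x ∈ cartierIdeal (p ^ e) t, x ∉ P := by
  obtain ⟨n, u, ρ, hρ, hu⟩ := exists_isCartierLinear_dual p hT e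
  by_contra! H
  refine ht ?_
  rw [hu t]
  exact Ideal.sum_mem _ fun i _ => Ideal.mul_mem_right _ _
    (Ideal.pow_mem_pow (H _ ⟨ρ i, hρ i, rfl⟩) _)

include hp in
/-- F-finite regular domains are Frobenius split. -/
theorem exists_isCartierLinear_one_eq_one (hT : IsFFinite p T) (e : ℕ) :
    ∃ ρ : T →+ T, IsCartierLinear (p ^ e) ρ ∧ ρ 1 = 1 := by
  have h : cartierIdeal (p ^ e) (1 : T) = ⊤ := by
    by_contra H
    obtain ⟨P, hP, hle⟩ := Ideal.exists_le_maximal _ H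
    obtain ⟨x, hx, hxP⟩ := exists_mem_cartierIdeal_notMem p hT e (t := 1) (P := P) fun h =>
      hP.ne_top ((Ideal.eq_top_iff_one _).2
        (Ideal.pow_le_self (pow_pos hp.out.pos e).ne' h))
    exact hxP (hle hx)
  exact (Ideal.eq_top_iff_one _).1 h

include hp in
/-- F-finite regular domains are strongly F-regular. -/
theorem exists_isCartierLinear_eq_one (hT : IsFFinite p T) {t : T} (ht : t ≠ 0) :
    ∃ (e : ℕ) (ρ : T →+ T), IsCartierLinear (p ^ e) ρ ∧ ρ t = 1 := by
  obtain ⟨σ, hσ, hσ1⟩ := exists_isCartierLinear_one_eq_one p hT 1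
  rw [pow_one] at hσ
  -- A splitting σ recovers y as σ(y^(p-1) · y), so a value reached at level e is also reached at
  -- level e + 1.
  have hmono : Monotone fun e => cartierIdeal (p ^ e) t := by
    refine monotone_nat_of_le_succ fun e => ?_
    rintro _ ⟨ρ, hρ, rfl⟩
    refine ⟨(σ.comp (AddMonoidHom.mulLeft (ρ t ^ (p - 1)))).comp ρ, ?_, ?_⟩
    · rw [pow_succ']
      exact (hσ.comp_mulLeft _).comp hρ
    · change σ (ρ t ^ (p - 1) * ρ t) = ρ t
      rw [pow_sub_one_mul hp.out.ne_zero]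
      simpa [hσ1] using hσ (ρ t) 1
  have htop : ⨆ e, cartierIdeal (p ^ e) t = ⊤ := by
    by_contra H
    obtain ⟨P, hP, hle⟩ := Ideal.exists_le_maximal _ H
    -- Krull's intersection theorem puts t outside some power of P.
    have hbot := P.iInf_pow_eq_bot_of_isDomain hP.ne_top
    obtain ⟨m, hm⟩ : ∃ m, t ∉ P ^ m := by
      by_contra! h
      exact ht ((Submodule.mem_bot T).1 (hbot ▸ (Submodule.mem_iInf _).2 h))
    obtain ⟨x, hx, hxP⟩ := exists_mem_cartierIdeal_notMem p hT m (t := t) (P := P) fun h =>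
      hm (Ideal.pow_le_pow_right (Nat.lt_pow_self hp.out.one_lt).le h)
    exact hxP (hle (Ideal.mem_iSup_of_mem m hx))
  have h1 : (1 : T) ∈ ⨆ e, cartierIdeal (p ^ e) t := htop ▸ Submodule.mem_top
  exact (Submodule.mem_iSup_of_directed _ hmono.directed_le).1 h1

include hp in
-- An integral fraction a/b has all its powers in T after multiplication by one d ≠ 0. Applying ρ
-- with ρ(d) = 1 to a^q d = b^q u gives a = bρ(u).
theorem isIntegrallyClosed_of_isRegularRing_of_isFFinite (hT : IsFFinite p T) :
    IsIntegrallyClosed T := by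
  rw [isIntegrallyClosed_iff (FractionRing T)]
  intro x hx
  obtain ⟨d, hd, hdx⟩ := hx.isAlmostIntegral
  obtain ⟨e, ρ, hρ, hρd⟩ := exists_isCartierLinear_eq_one p hT (nonZeroDivisors.ne_zero hd)
  obtain ⟨a, b, hb, rfl⟩ := IsFractionRing.div_surjective (A := T) x
  obtain ⟨u, hu⟩ := hdx (p ^ e)
  have hb0 : algebraMap T (FractionRing T) b ≠ 0 :=
    IsFractionRing.to_map_ne_zero_of_mem_nonZeroDivisors hb
  have h1 : a ^ p ^ e * d = b ^ p ^ e * u := by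
    apply IsFractionRing.injective T (FractionRing T)
    rw [map_mul, map_mul, hu, Algebra.smul_def, div_pow, map_pow, map_pow]
    field_simp
  have h2 : a = b * ρ u := by
    rw [← hρ, ← h1, hρ, hρd, mul_one]
  refine ⟨ρ u, ?_⟩
  rw [eq_div_iff hb0, ← map_mul, mul_comm, ← h2]

end CartierLinear

/-! ### Differential operators in characteristic p -/

section DiffOp

universe u

variable (p : ℕ) [hp : Fact p.Prime] {R : Type u} [CommRing R] [CharP R p]

/-- The commutator with multiplication by `r`, as an endomorphism of `End_ℤ(R)`. -/
def mulCommutator (R : Type u) [CommRing R] (r : R) : Module.End ℤ (Module.End ℤ R) :=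
  LinearMap.mulLeft ℤ (LinearMap.mulLeft ℤ r) - LinearMap.mulRight ℤ (LinearMap.mulLeft ℤ r)

theorem mulCommutator_apply (r : R) (θ : Module.End ℤ R) :
    mulCommutator R r θ = LinearMap.mulLeft ℤ r * θ - θ * LinearMap.mulLeft ℤ r := rfl

theorem mulCommutator_commute (r s : R) : Commute (mulCommutator R r) (mulCommutator R s) := by
  have h : LinearMap.mulLeft ℤ r * LinearMap.mulLeft ℤ s =
      LinearMap.mulLeft ℤ s * LinearMap.mulLeft ℤ r := by
    ext x; simp [mul_left_comm]
  refine LinearMap.ext fun θ => ?_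
  simp only [Module.End.mul_apply, mulCommutator_apply, mul_sub, sub_mul]
  have h1 : LinearMap.mulLeft ℤ r * (LinearMap.mulLeft ℤ s * θ) =
      LinearMap.mulLeft ℤ s * (LinearMap.mulLeft ℤ r * θ) := by
    rw [← mul_assoc, h, mul_assoc]
  have h2 : θ * LinearMap.mulLeft ℤ s * LinearMap.mulLeft ℤ r =
      θ * LinearMap.mulLeft ℤ r * LinearMap.mulLeft ℤ s := by
    rw [mul_assoc, ← h, mul_assoc]
  rw [h1, h2]
  simp only [mul_assoc]
  abel

/-- Left and right multiplications commute, so the binomial formula in characteristic p applies to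
their difference. -/
theorem mulCommutator_pow_char_pow [Nontrivial R] (r : R) (e : ℕ) :
    mulCommutator R r ^ p ^ e = mulCommutator R (r ^ p ^ e) := by
  have hE : CharP (Module.End ℤ (Module.End ℤ R)) p := by
    refine (CharP.charP_iff_prime_eq_zero hp.out).2 ?_
    ext θ x
    rw [← nsmul_one, LinearMap.smul_apply, LinearMap.smul_apply, nsmul_eq_mul, CharP.cast_eq_zero,
      zero_mul]
    rfl
  rw [mulCommutator, sub_pow_char_pow_of_commute _ _ (LinearMap.commute_mulLeft_right ..)]
  simp only [mulCommutator, LinearMap.pow_mulLeft, LinearMap.pow_mulRight]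

theorem mulCommutator_eq_zero_iff {r : R} {θ : Module.End ℤ R} :
    mulCommutator R r θ = 0 ↔ ∀ x, θ (r * x) = r * θ x := by
  rw [mulCommutator_apply, sub_eq_zero, LinearMap.ext_iff]
  exact forall_congr' fun x => eq_comm

theorem IsDiffOp.mulCommutator_pow_eq_zero {n : ℕ} {θ : Module.End ℤ R} (h : IsDiffOp ℤ R n θ)
    (r : R) : (mulCommutator R r ^ (n + 1)) θ = 0 := by
  induction n generalizing θ with
  | zero => rw [zero_add, pow_one, mulCommutator_eq_zero_iff]; exact h r
  | succ n ih => rw [pow_succ, Module.End.mul_apply]; exact ih (h r)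

theorem IsDiffOp.sum {ι : Type*} (s : Finset ι) {n : ℕ} {θ : ι → Module.End ℤ R}
    (h : ∀ i ∈ s, IsDiffOp ℤ R n (θ i)) : IsDiffOp ℤ R n (∑ i ∈ s, θ i) :=
  Finset.sum_induction _ (IsDiffOp ℤ R n) (fun _ _ => IsDiffOp.add) (IsDiffOp.zero_op n) h

theorem IsDiffOp.mulLeft_mul {n : ℕ} {θ : Module.End ℤ R} (h : IsDiffOp ℤ R n θ) (a : R) :
    IsDiffOp ℤ R n (LinearMap.mulLeft ℤ a * θ) := by
  have ha : IsDiffOp ℤ R 0 (LinearMap.mulLeft ℤ a) := fun r x => by simp [mul_left_comm]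
  simpa using ha.mul h

/-- Operators that are linear over `q`-th powers and killed by powers of the commutators with
generators of the ring over its `q`-th powers are differential operators. -/
theorem isDiffOp_of_mulCommutator_pow_eq_zero {m q : ℕ} {g : Fin m → R}
    (hg : ∀ r, ∃ a : Fin m → R, r = ∑ i, a i ^ q * g i) (N : ℕ) (k : Fin m → ℕ)
    (hk : ∑ i, k i ≤ N) {θ : Module.End ℤ R} (hθ : ∀ r, mulCommutator R (r ^ q) θ = 0)
    (h : ∀ i, (mulCommutator R (g i) ^ k i) θ = 0) : IsDiffOp ℤ R N θ := by
  induction N generalizing k θ with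
  | zero =>
    intro r x
    obtain ⟨a, rfl⟩ := hg r
    have hθ0 (i : Fin m) : θ = 0 := by
      have : k i = 0 := Nat.le_zero.1 ((Finset.single_le_sum (fun _ _ => Nat.zero_le _)
        (Finset.mem_univ i)).trans hk)
      simpa [this] using h i
    simp only [Finset.sum_mul, map_sum]
    refine Finset.sum_congr rfl fun i _ => ?_
    rw [hθ0 i]; simp
  | succ N ih =>
    intro r
    obtain ⟨a, rfl⟩ := hg r
    have hsum : LinearMap.mulLeft ℤ (∑ i, a i ^ q * g i) * θ -
        θ * LinearMap.mulLeft ℤ (∑ i, a i ^ q * g i) =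
        ∑ i, LinearMap.mulLeft ℤ (a i ^ q) * mulCommutator R (g i) θ := by
      ext x
      simp only [LinearMap.sub_apply, Module.End.mul_apply, LinearMap.mulLeft_apply,
        Finset.sum_mul, map_sum, LinearMap.coe_sum, Finset.sum_apply, mulCommutator_apply]
      rw [← Finset.sum_sub_distrib]
      refine Finset.sum_congr rfl fun i _ => ?_
      rw [mul_assoc, mul_assoc, mulCommutator_eq_zero_iff.1 (hθ (a i)), mul_sub]
    rw [hsum]
    refine IsDiffOp.sum _ fun i _ => IsDiffOp.mulLeft_mul ?_ _
    rcases Nat.eq_zero_or_pos (k i) with h0 | hpos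
    · have : θ = 0 := by simpa [h0] using h i
      rw [this, map_zero]
      exact IsDiffOp.zero_op N
    -- One commutator with `g i` uses up one unit of `k i`; commuting commutators preserve the other
    -- vanishing conditions.
    · refine ih (Function.update k i (k i - 1)) ?_ (fun r => ?_) fun j => ?_
      · have h1 : ∑ j, Function.update k i (k i - 1) j < ∑ j, k j := by
          refine Finset.sum_lt_sum (fun j _ => ?_) ⟨i, Finset.mem_univ i, ?_⟩
          · rcases eq_or_ne j i with rfl | hj
            · simp
            · simp [hj]
          · simpa using hpos
        omega
      · rw [← Module.End.mul_apply, (mulCommutator_commute _ _).eq, Module.End.mul_apply, hθ,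
          map_zero]
      · rcases eq_or_ne j i with rfl | hj
        · rw [Function.update_self, ← Module.End.mul_apply, ← pow_succ, Nat.sub_add_cancel hpos]
          exact h j
        · rw [Function.update_of_ne hj, ← Module.End.mul_apply,
            ((mulCommutator_commute _ _).pow_left _).eq, Module.End.mul_apply, h j, map_zero]

include hp in
theorem exists_generators_pow (hR : IsFFinite p R) (e : ℕ) :
    ∃ (m : ℕ) (g : Fin m → R), ∀ r, ∃ a : Fin m → R, r = ∑ i, a i ^ p ^ e * g i := by
  induction e with
  | zero => exact ⟨1, fun _ => 1, fun r => ⟨fun _ => r, by simp⟩⟩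
  | succ e ih =>
    obtain ⟨m, g, hg⟩ := ih
    obtain ⟨n, f, hf⟩ : ∃ (n : ℕ) (f : Fin n → R), ∀ r, ∃ a : Fin n → R,
        r = ∑ i, a i ^ p * f i := by
      have := hR.finite_frobeniusTwist
      obtain ⟨n, f, hf⟩ := Module.Finite.exists_fin (R := R) (M := FrobeniusTwist p R)
      refine ⟨n, f, fun r => ?_⟩
      have hr : FrobeniusTwist.equiv p R r ∈ Submodule.span R (Set.range f) := hf ▸ trivial
      obtain ⟨a, ha⟩ := (Submodule.mem_span_range_iff_exists_fun R).1 hr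
      exact ⟨a, ha.symm⟩
    refine ⟨n * m, fun k => g (finProdFinEquiv.symm k).2 ^ p * f (finProdFinEquiv.symm k).1,
      fun r => ?_⟩
    obtain ⟨a, ha⟩ := hf r
    choose b hb using fun i => hg (a i)
    refine ⟨fun k => b (finProdFinEquiv.symm k).1 (finProdFinEquiv.symm k).2, ?_⟩
    rw [← finProdFinEquiv.sum_comp, Fintype.sum_prod_type]
    simp only [Equiv.symm_apply_apply]
    conv_lhs => rw [ha]
    refine Finset.sum_congr rfl fun i _ => ?_
    conv_lhs => rw [hb i]
    rw [sum_pow_char, Finset.sum_mul]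
    refine Finset.sum_congr rfl fun j _ => ?_
    rw [mul_pow, ← pow_mul, ← pow_succ, mul_assoc]

include hp in
/-- Over an F-finite ring, the differential operators are the additive maps that are linear over
the `p ^ e`-th powers for some `e`. -/
theorem mem_diffOpRing_iff_of_isFFinite (hR : IsFFinite p R) {θ : Module.End ℤ R} :
    θ ∈ diffOpRing ℤ R ↔ ∃ e : ℕ, ∀ r x, θ (r ^ p ^ e * x) = r ^ p ^ e * θ x := by
  have : Nontrivial R := CharP.nontrivial_of_char_ne_one hp.out.ne_one
  constructor
  · rintro ⟨n, hn⟩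
    -- Order n is killed by n + 1 commutators with r, hence by p^(n+1) ≥ n + 1 of them, which amount
    -- to one commutator with r^(p^(n+1)).
    refine ⟨n + 1, fun r => mulCommutator_eq_zero_iff.1 ?_⟩
    rw [← mulCommutator_pow_char_pow]
    have hle : n + 1 ≤ p ^ (n + 1) := (Nat.lt_pow_self hp.out.one_lt).le
    rw [← Nat.sub_add_cancel hle, pow_add, Module.End.mul_apply, hn.mulCommutator_pow_eq_zero,
      map_zero]
  · rintro ⟨e, he⟩
    obtain ⟨m, g, hg⟩ := exists_generators_pow p hR e
    refine ⟨_, isDiffOp_of_mulCommutator_pow_eq_zero hg _ (fun _ => p ^ e) le_rfl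
      (fun r => mulCommutator_eq_zero_iff.2 (he r)) fun i => ?_⟩
    rw [mulCommutator_pow_char_pow]
    exact mulCommutator_eq_zero_iff.2 (he _)

end DiffOp

/-! ### Traces and discriminants of finite smooth algebras -/

section SmoothTrace

universe u v w

open Polynomial in
/-- Smooth algebras over fields are reduced. -/
theorem Algebra.Smooth.isReduced_of_field (K : Type u) (S : Type v) [Field K] [CommRing S]
    [Algebra K S] [Algebra.Smooth K S] : IsReduced S := by
  refine ⟨fun s hs => ?_⟩
  have hnil : IsNilpotent (s ⊗ₜ[K] (X : K[X])) := by
    obtain ⟨n, hn⟩ := hs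
    exact ⟨n, by rw [Algebra.TensorProduct.tmul_pow, hn, TensorProduct.zero_tmul]⟩
  have hint : IsIntegral S (s ⊗ₜ[K] (X : K[X])) := by
    obtain ⟨n, hn⟩ := hnil
    refine IsIntegral.of_pow (n := n + 1) n.succ_pos ?_
    rw [pow_succ, hn, zero_mul]
    exact isIntegral_zero
  -- Integral closure commutes with smooth base change and K is integrally closed in K[X]. So the
  -- nilpotent s ⊗ X comes from constants, and its X-coefficient s vanishes.
  obtain ⟨y, hy⟩ := (TensorProduct.toIntegralClosure_bijective_of_smooth (R := K) (S := S)
    (B := K[X])).2 ⟨_, hint⟩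
  let φ : S ⊗[K] K[X] →ₗ[K] S :=
    (_root_.TensorProduct.rid K S).toLinearMap ∘ₗ LinearMap.lTensor S (Polynomial.lcoeff K 1)
  have hφ : ∀ (a : S) (f : K[X]), φ (a ⊗ₜ f) = f.coeff 1 • a := fun a f => by simp [φ]
  have hzero : ∀ y : S ⊗[K] integralClosure K K[X],
      φ (TensorProduct.toIntegralClosure K S K[X] y : S ⊗[K] K[X]) = 0 := by
    intro y
    induction y with
    | zero => simp
    | add x y hx hy => rw [map_add, Subalgebra.coe_add, map_add, hx, hy, add_zero]
    | tmul a f =>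
      change φ (a ⊗ₜ (f : K[X])) = 0
      have hdeg : (f : K[X]).natDegree = 0 := by
        by_contra h
        have := (Polynomial.transcendental_X K).aeval (f : K[X]) h
          (mem_nonZeroDivisors_of_ne_zero (leadingCoeff_ne_zero.2 (by rintro h0; simp [h0] at h)))
        rw [Polynomial.aeval_X_left_apply] at this
        exact this (_root_.IsIntegral.isAlgebraic f.2)
      rw [hφ, Polynomial.coeff_eq_zero_of_natDegree_lt (by omega), zero_smul]
  have := hzero y
  rw [hy, hφ, Polynomial.coeff_X_one, one_smul] at this
  exact this

/-- Finite reduced algebras over algebraically closed fields are split. -/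
theorem exists_algEquiv_pi_of_isAlgClosed (F : Type u) (A : Type v) [Field F] [IsAlgClosed F]
    [CommRing A] [Algebra F A] [Module.Finite F A] [IsReduced A] :
    ∃ (n : ℕ), Nonempty (A ≃ₐ[F] (Fin n → F)) := by
  have : IsArtinianRing A := IsArtinianRing.of_finite F A
  have hbij (I : MaximalSpectrum A) : Function.Bijective (algebraMap F (A ⧸ I.asIdeal)) := by
    have := I.isMaximal
    exact IsAlgClosed.algebraMap_bijective_of_isIntegral
  have := Fintype.ofFinite (MaximalSpectrum A)
  exact ⟨_, ⟨((IsArtinianRing.equivPi A).restrictScalars F).trans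
    ((AlgEquiv.piCongrRight fun I => (AlgEquiv.ofBijective (Algebra.ofId F (A ⧸ I.asIdeal))
      (hbij I)).symm).trans
    (AlgEquiv.piCongrLeft F (fun _ => F) (Fintype.equivFin (MaximalSpectrum A))))⟩⟩

theorem Algebra.trace_pi_apply (F : Type u) [CommRing F] {n : ℕ} (x : Fin n → F) :
    Algebra.trace F (Fin n → F) x = ∑ k, x k := by
  rw [Algebra.trace_eq_matrix_trace (Pi.basisFun F (Fin n)), Matrix.trace]
  refine Finset.sum_congr rfl fun k _ => ?_
  simp [Algebra.leftMulMatrix_eq_repr_mul]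

theorem Algebra.traceForm_pi_nondegenerate (F : Type u) [CommRing F] (n : ℕ) :
    (Algebra.traceForm F (Fin n → F)).Nondegenerate := by
  have key (x : Fin n → F) (k : Fin n) :
      Algebra.trace F (Fin n → F) (x * Pi.single k 1) = x k := by
    rw [Algebra.trace_pi_apply]
    simp [Pi.single_apply]
  constructor
  · intro x hx
    funext k
    rw [← key x k]
    exact hx _
  · intro x hx
    funext k
    rw [← key x k, mul_comm]
    exact hx _

/-- The trace of a finite smooth algebra over a field is the sum of its geometric points, and its
discriminant does not vanish. -/
theorem Algebra.Smooth.exists_algHom_trace_eq_sum_and_discr_ne_zero (K : Type u) (A : Type v)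
    [Field K] [CommRing A] [Algebra K A] [Algebra.Smooth K A] [Module.Finite K A] :
    (∃ (n : ℕ) (ε : Fin n → A →ₐ[K] AlgebraicClosure K),
      ∀ a, algebraMap K (AlgebraicClosure K) (Algebra.trace K A a) = ∑ k, ε k a) ∧
    ∀ {m : ℕ} (b : Module.Basis (Fin m) K A), Algebra.discr K b ≠ 0 := by
  let F := AlgebraicClosure K
  -- Smoothness survives base change, so this algebra becomes Fⁿ, where the trace is the sum of the
  -- coordinates.
  have : IsReduced (F ⊗[K] A) := Algebra.Smooth.isReduced_of_field F (F ⊗[K] A)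
  obtain ⟨n, ⟨E⟩⟩ := exists_algEquiv_pi_of_isAlgClosed F (F ⊗[K] A)
  have htr (a : A) : algebraMap K F (Algebra.trace K A a) =
      Algebra.trace F (F ⊗[K] A) (1 ⊗ₜ a) := by
    rw [Algebra.trace_apply, Algebra.trace_apply, ← LinearMap.trace_baseChange]
    congr 1
    ext x
    simp
  refine ⟨⟨n, fun k => (Pi.evalAlgHom K (fun _ => F) k).comp
    ((E.toAlgHom.restrictScalars K).comp Algebra.TensorProduct.includeRight), fun a => ?_⟩,
    fun {m} b hb => ?_⟩
  · rw [htr, ← Algebra.trace_eq_of_algEquiv E, Algebra.trace_pi_apply]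
    rfl
  · let b' := (Algebra.TensorProduct.basis F b).map E.toLinearEquiv
    have h1 : Algebra.discr F b' = algebraMap K F (Algebra.discr K b) := by
      have : (b' : Fin m → Fin n → F) = E ∘ (fun i => (1 : F) ⊗ₜ[K] b i) := by
        funext i; simp [b']
      rw [this, ← Algebra.discr_eq_discr_of_algEquiv, Algebra.discr_def, Algebra.discr_def,
        RingHom.map_det]
      congr 1
      ext i j
      simp [Algebra.traceMatrix_apply, Algebra.traceForm_apply, htr]
    rw [hb, map_zero, Algebra.discr_def, Algebra.traceMatrix_of_basis] at h1
    exact (LinearMap.BilinForm.nondegenerate_iff_det_ne_zero b').1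
      (Algebra.traceForm_pi_nondegenerate F n) h1

end SmoothTrace

/-! ### Trace duality and extension of Cartier linear maps -/

section TraceDual

universe u v w

/-- A `T`-linear map `tr : R → T` together with families `r`, `s` that are dual to each other
up to the factor `c`, such that `tr` commutes with Frobenius. -/
structure TraceDual (p : ℕ) (T : Type u) (R : Type v) [CommRing T] [CommRing R] [Algebra T R]
    (c : T) where
  tr : R →ₗ[T] T
  tr_pow_char : ∀ x, tr (x ^ p) = tr x ^ p
  n : ℕ
  r : Fin n → R
  s : Fin n → R
  smul_eq_sum_r : ∀ x, c • x = ∑ i, tr (x * s i) • r i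
  smul_eq_sum_s : ∀ x, c • x = ∑ i, tr (x * r i) • s i

namespace TraceDual

variable {p : ℕ} [hp : Fact p.Prime] {T : Type u} {R : Type v} [CommRing T] [CommRing R]
  [Algebra T R] [CharP T p] [CharP R p] {c : T} (D : TraceDual p T R c)

omit hp [CharP T p] [CharP R p] in
theorem tr_pow_char_pow (e : ℕ) (x : R) : D.tr (x ^ p ^ e) = D.tr x ^ p ^ e := by
  induction e with
  | zero => simp
  | succ e ih => rw [pow_succ, pow_mul, D.tr_pow_char, ih, ← pow_mul]

/-- The extension to `R` of a Cartier linear map on `T`, multiplied by `c`. -/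
def extend (q : ℕ) (ρ : T →+ T) : R →+ R where
  -- An extension ρ' compatible with trace has coordinates tr(ρ'(x)sᵢ/c) = ρ(tr(x sᵢ^q)/c^q) =
  -- ρ(tr(x sᵢ^q))/c along rᵢ. Multiplying by c clears the denominator.
  toFun x := ∑ i, ρ (D.tr (x * D.s i ^ q)) • D.r i
  map_zero' := by simp
  map_add' x y := by simp [add_mul, add_smul, Finset.sum_add_distrib]

omit hp [CharP T p] [CharP R p] in
theorem extend_apply (q : ℕ) (ρ : T →+ T) (x : R) :
    D.extend q ρ x = ∑ i, ρ (D.tr (x * D.s i ^ q)) • D.r i := rfl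

omit hp [CharP T p] [CharP R p] in
theorem extend_algebraMap {e : ℕ} {ρ : T →+ T} (hρ : IsCartierLinear (p ^ e) ρ) (t : T) :
    D.extend (p ^ e) ρ (algebraMap T R t) = algebraMap T R (c * ρ t) := by
  have h (i) : ρ (D.tr (algebraMap T R t * D.s i ^ p ^ e)) = ρ t * D.tr (1 * D.s i) := by
    rw [← Algebra.smul_def, map_smul, D.tr_pow_char_pow, smul_eq_mul, mul_comm t, hρ, one_mul,
      mul_comm]
  rw [extend_apply]
  simp only [h, mul_smul]
  rw [← Finset.smul_sum, ← D.smul_eq_sum_r, smul_smul, ← Algebra.algebraMap_eq_smul_one,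
    mul_comm]

include hp in
omit [CharP T p] in
-- By duality, one matrix M expresses multiplication by a on the sᵢ and, transposed, on the rᵢ, up
-- to the factor c. Frobenius turns M into M^q entrywise, and ρ turns it back into M.
theorem isCartierLinear_extend (hc : ∀ x y : R, c • x = c • y → x = y) {e : ℕ} {ρ : T →+ T}
    (hρ : IsCartierLinear (p ^ e) ρ) : IsCartierLinear (p ^ e) (D.extend (p ^ e) ρ) := by
  intro a x
  apply hc
  let M : Fin D.n → Fin D.n → T := fun i j => D.tr (a * D.s i * D.r j)
  have h1 (i) : c * ρ (D.tr (a ^ p ^ e * x * D.s i ^ p ^ e)) =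
      ∑ j, M i j * ρ (D.tr (x * D.s j ^ p ^ e)) := by
    have h2 : c ^ p ^ e • (a ^ p ^ e * x * D.s i ^ p ^ e) =
        ∑ j, M i j ^ p ^ e • (x * D.s j ^ p ^ e) := by
      have := congrArg (fun z => x * z ^ p ^ e) (D.smul_eq_sum_s (a * D.s i))
      simp only [smul_pow, mul_pow, sum_pow_char_pow, Finset.mul_sum, mul_smul_comm] at this
      rw [← this]
      congr 1
      ring
    have h3 := congrArg (fun z => ρ (D.tr z)) h2
    simp only [map_sum, map_smul, smul_eq_mul] at h3
    rw [hρ] at h3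
    rw [h3]
    exact Finset.sum_congr rfl fun j _ => hρ _ _
  have h4 (j) : c • (a * D.r j) = ∑ i, M i j • D.r i := by
    rw [D.smul_eq_sum_r]
    refine Finset.sum_congr rfl fun i _ => ?_
    rw [mul_right_comm]
  rw [extend_apply, extend_apply, Finset.smul_sum, Finset.mul_sum, Finset.smul_sum]
  simp only [smul_smul, h1, Finset.sum_smul]
  rw [Finset.sum_comm]
  refine Finset.sum_congr rfl fun j _ => ?_
  rw [mul_smul_comm, smul_comm, h4, Finset.smul_sum]
  refine Finset.sum_congr rfl fun i _ => ?_
  rw [smul_smul, mul_comm]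

end TraceDual

/-- A discriminant of a generically smooth finite extension of a normal domain gives rise to
trace-dual families. -/
theorem IsDiscriminant.nonempty_traceDual {p : ℕ} [hp : Fact p.Prime] {T : Type u} {R : Type v}
    {K : Type w} [CommRing T] [CommRing R] [Field K] [IsDomain T] [IsIntegrallyClosed T]
    [CharP T p] [Algebra T K] [IsFractionRing T K] [Algebra T R] [Module.Finite T R]
    [Algebra.Smooth K (K ⊗[T] R)]
    (hinj : Function.Injective (Algebra.TensorProduct.includeRight : R →ₐ[T] K ⊗[T] R))
    {c : T} (hc : IsDiscriminant T R K c) : Nonempty (TraceDual p T R c) := by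
  obtain ⟨⟨n, ε, hε⟩, -⟩ :=
    Algebra.Smooth.exists_algHom_trace_eq_sum_and_discr_ne_zero K (K ⊗[T] R)
  have hTK := IsFractionRing.injective T K
  have hKF := (algebraMap K (AlgebraicClosure K)).injective
  -- The trace is a sum of images of x under ring maps, hence integral, and T is normal.
  have hex (x : R) : ∃ t : T, algebraMap T K t = Algebra.trace K (K ⊗[T] R) (1 ⊗ₜ x) := by
    refine IsIntegrallyClosed.isIntegral_iff.1 ?_
    rw [← isIntegral_algebraMap_iff hKF, hε]
    refine IsIntegral.sum _ fun k _ => ?_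
    exact (Algebra.IsIntegral.isIntegral (R := T) x).map
      (((ε k).restrictScalars T).comp Algebra.TensorProduct.includeRight)
  choose f hf using hex
  let tr : R →ₗ[T] T :=
    { toFun := f
      map_add' := fun x y => hTK (by
        rw [map_add, hf, hf, hf, TensorProduct.tmul_add, map_add])
      map_smul' := fun t x => hTK (by
        rw [RingHom.id_apply, smul_eq_mul, map_mul, hf, hf, TensorProduct.tmul_smul,
          ← algebraMap_smul K t, map_smul, smul_eq_mul]) }
  have htr (x : R) : algebraMap T K (tr x) = Algebra.trace K (K ⊗[T] R) (1 ⊗ₜ x) := hf x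
  have : CharP (AlgebraicClosure K) p :=
    charP_of_injective_ringHom (f := (algebraMap K (AlgebraicClosure K)).comp (algebraMap T K))
      (hKF.comp hTK) p
  have htrp (x : R) : tr (x ^ p) = tr x ^ p := by
    apply hTK
    apply hKF
    rw [htr, map_pow (algebraMap T K), map_pow, htr, hε, hε, sum_pow_char]
    refine Finset.sum_congr rfl fun k _ => ?_
    rw [← map_pow, Algebra.TensorProduct.tmul_pow, one_pow]
  obtain ⟨m, r, b, hb, hcdet⟩ := hc
  -- The adjugate of the Gram matrix produces the dual family without division, at the cost of the
  -- factor det G = c.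
  let G : Matrix (Fin m) (Fin m) T := Matrix.of fun i j => tr (r i * r j)
  have hG : G.det = c := by
    apply hTK
    rw [hcdet, RingHom.map_det]
    congr 1
    ext i j
    simp [G, htr]
  have hGs : G.transpose = G := by ext i j; simp [G, mul_comm]
  have hadj : G.adjugate.transpose = G.adjugate := by rw [Matrix.adjugate_transpose, hGs]
  have key (x : R) : c • x = ∑ i, ∑ j, (G.adjugate i j * tr (x * r j)) • r i := by
    apply hinj
    obtain ⟨a, ha⟩ : ∃ a : Fin m → K, (1 : K) ⊗ₜ[T] x = ∑ k, a k • b k :=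
      ⟨_, (b.sum_repr _).symm⟩
    have h1 (j) : algebraMap T K (tr (x * r j)) = ∑ k, algebraMap T K (G j k) * a k := by
      have : (1 : K) ⊗ₜ[T] (x * r j) = ∑ k, a k • ((1 : K) ⊗ₜ[T] (r j * r k)) := by
        rw [← one_mul (1 : K), ← Algebra.TensorProduct.tmul_mul_tmul, ha, Finset.sum_mul]
        refine Finset.sum_congr rfl fun k _ => ?_
        rw [hb, smul_mul_assoc, Algebra.TensorProduct.tmul_mul_tmul, one_mul, mul_comm (r k)]
      rw [htr, this, map_sum]
      refine Finset.sum_congr rfl fun k _ => ?_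
      rw [map_smul, ← htr, smul_eq_mul, mul_comm]
      rfl
    have h2 (i) : ∑ j, algebraMap T K (G.adjugate i j * tr (x * r j)) =
        algebraMap T K c * a i := by
      have h3 (k) : ∑ j, G.adjugate i j * G j k = if i = k then c else 0 := by
        have := congrFun (congrFun G.adjugate_mul i) k
        rw [Matrix.mul_apply, hG] at this
        rw [this, Matrix.smul_apply, Matrix.one_apply, smul_eq_mul, mul_ite, mul_one, mul_zero]
      have h4 (k) : ∑ j, algebraMap T K (G.adjugate i j) * (algebraMap T K (G j k) * a k) =
          algebraMap T K (if i = k then c else 0) * a k := by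
        rw [← h3, map_sum, Finset.sum_mul]
        exact Finset.sum_congr rfl fun j _ => by rw [map_mul, mul_assoc]
      simp only [map_mul, h1, Finset.mul_sum]
      rw [Finset.sum_comm]
      simp [h4, apply_ite (algebraMap T K), ite_mul]
    have h4 (t : T) (y : R) : (Algebra.TensorProduct.includeRight : R →ₐ[T] K ⊗[T] R) (t • y) =
        algebraMap T K t • ((1 : K) ⊗ₜ[T] y) := by
      rw [map_smul, algebraMap_smul]; rfl
    rw [h4, ha, map_sum, Finset.smul_sum]
    refine Finset.sum_congr rfl fun i _ => ?_
    rw [map_sum]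
    simp only [h4]
    rw [← Finset.sum_smul, h2, hb, smul_smul]
  refine ⟨⟨tr, htrp, m, r, fun i => ∑ j, G.adjugate i j • r j, fun x => ?_, fun x => ?_⟩⟩
  · rw [key]
    refine Finset.sum_congr rfl fun i _ => ?_
    rw [← Finset.sum_smul, Finset.mul_sum, map_sum]
    simp only [mul_smul_comm, map_smul, smul_eq_mul]
  · rw [key, Finset.sum_comm]
    refine Finset.sum_congr rfl fun j _ => ?_
    rw [Finset.smul_sum]
    refine Finset.sum_congr rfl fun i _ => ?_
    rw [smul_smul, mul_comm, ← Matrix.transpose_apply G.adjugate, hadj]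

end TraceDual

/-! ### Carrying elements to 1, and simplicity -/

section Simplicity

universe u v w

variable {p : ℕ} [hp : Fact p.Prime] {T : Type u} {R : Type v} [CommRing T] [CommRing R]
  [IsDomain T] [IsRegularRing T] [CharP T p] [CharP R p] [Algebra T R]

theorem mulLeft_mem_diffOpRing (a : R) : LinearMap.mulLeft ℤ a ∈ diffOpRing ℤ R :=
  ⟨0, fun r x => by simp [mul_left_comm]⟩

/-- A Cartier linear map followed by the corresponding Frobenius power is a differential
operator. -/
theorem IsCartierLinear.frobenius_comp_mem_diffOpRing (hR : IsFFinite p R) {e : ℕ} {ρ : R →+ R}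
    (hρ : IsCartierLinear (p ^ e) ρ) :
    ((iterateFrobenius R p e : R →+ R).comp ρ).toIntLinearMap ∈ diffOpRing ℤ R :=
  (mem_diffOpRing_iff_of_isFFinite p hR).2 ⟨e, fun r x => by
    change ρ (r ^ p ^ e * x) ^ p ^ e = r ^ p ^ e * ρ x ^ p ^ e
    rw [hρ, mul_pow]⟩

theorem exists_mem_diffOpRing_pow_succ_eq_one (hT : IsFFinite p T) (hR : IsFFinite p R) {c : T}
    (D : TraceDual p T R c) (hc : ∀ x y : R, c • x = c • y → x = y) {N : ℕ} (hN : 0 < N)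
    (h : ∃ θ ∈ diffOpRing ℤ R, θ (algebraMap T R c ^ (N + 1)) = 1) :
    ∃ θ ∈ diffOpRing ℤ R, θ (algebraMap T R c ^ (N + 1 + 1)) = 1 := by
  obtain ⟨θ, hθ, hθc⟩ := h
  obtain ⟨e, he⟩ := (mem_diffOpRing_iff_of_isFFinite p hR).1 hθ
  obtain ⟨ρ, hρ, hρ1⟩ := exists_isCartierLinear_one_eq_one p hT e
  have hσ := D.isCartierLinear_extend hc hρ
  have hσ1 : D.extend (p ^ e) ρ 1 = algebraMap T R c := by
    rw [← map_one (algebraMap T R), D.extend_algebraMap hρ, hρ1, mul_one]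
  set σ := D.extend (p ^ e) ρ
  set d := algebraMap T R c
  let Φ : R →+ R := (iterateFrobenius R p e : R →+ R).comp
    (θ.toAddMonoidHom.comp (σ.comp θ.toAddMonoidHom))
  have hΦapply (x : R) : Φ x = θ (σ (θ x)) ^ p ^ e := rfl
  have hΦ : Φ.toIntLinearMap ∈ diffOpRing ℤ R := by
    -- σ takes one q-th root of r^(q²); the outer Frobenius restores it.
    refine (mem_diffOpRing_iff_of_isFFinite p hR).2 ⟨e + e, fun r x => ?_⟩
    change Φ _ = _ * Φ _
    rw [hΦapply, hΦapply, pow_add, pow_mul, he, hσ, he, mul_pow]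
  -- The multiplier fills the gap between N + 2 and Nq + N + 1, which is nonnegative because N ≥ 1.
  have hval : Φ (d ^ ((p ^ e - 1) * N + (N - 1)) * d ^ (N + 1 + 1)) = 1 := by
    have hq : 0 < p ^ e := pow_pos hp.out.pos e
    have h1 : d ^ ((p ^ e - 1) * N + (N - 1)) * d ^ (N + 1 + 1) =
        (d ^ N) ^ p ^ e * d ^ (N + 1) := by
      rw [← pow_add, ← pow_mul, ← pow_add]
      congr 1
      obtain ⟨q, hq⟩ : ∃ q, p ^ e = q + 1 := ⟨p ^ e - 1, by omega⟩
      rw [hq, Nat.add_sub_cancel, Nat.mul_succ, mul_comm N q]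
      omega
    rw [hΦapply, h1, he, hθc, hσ, hσ1, ← pow_succ, hθc, one_pow]
  exact ⟨Φ.toIntLinearMap * LinearMap.mulLeft ℤ (d ^ ((p ^ e - 1) * N + (N - 1))),
    mul_mem hΦ (mulLeft_mem_diffOpRing _), hval⟩

theorem exists_mem_diffOpRing_pow_eq_one (hT : IsFFinite p T) (hR : IsFFinite p R) {c : T}
    (D : TraceDual p T R c) (hc : ∀ x y : R, c • x = c • y → x = y)
    (h : ∃ θ ∈ diffOpRing ℤ R, θ (algebraMap T R c ^ 2) = 1) (N : ℕ) :
    ∃ θ ∈ diffOpRing ℤ R, θ (algebraMap T R c ^ N) = 1 := by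
  have key : ∀ N, ∃ θ ∈ diffOpRing ℤ R, θ (algebraMap T R c ^ (N + 2)) = 1 := fun N => by
    induction N with
    | zero => exact h
    | succ N ih => exact exists_mem_diffOpRing_pow_succ_eq_one hT hR D hc N.succ_pos ih
  obtain ⟨θ, hθ, hθc⟩ := key N
  refine ⟨θ * LinearMap.mulLeft ℤ (algebraMap T R c ^ 2), mul_mem hθ (mulLeft_mem_diffOpRing _), ?_⟩
  rw [Module.End.mul_apply, LinearMap.mulLeft_apply, ← pow_add, add_comm, hθc]

/-- Choosing ρ(t) = 1, the extension sends t to c, Frobenius makes this a differential operator with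
value c^q, and every power of c can be carried to 1. -/
theorem exists_mem_diffOpRing_algebraMap_eq_one (hT : IsFFinite p T) (hR : IsFFinite p R) {c : T}
    (D : TraceDual p T R c) (hc : ∀ x y : R, c • x = c • y → x = y)
    (h : ∃ θ ∈ diffOpRing ℤ R, θ (algebraMap T R c ^ 2) = 1) {t : T} (ht : t ≠ 0) :
    ∃ θ ∈ diffOpRing ℤ R, θ (algebraMap T R t) = 1 := by
  obtain ⟨e, ρ, hρ, hρt⟩ := exists_isCartierLinear_eq_one p hT ht
  obtain ⟨θ, hθ, hθc⟩ := exists_mem_diffOpRing_pow_eq_one hT hR D hc h (p ^ e)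
  refine ⟨_, mul_mem hθ
    (IsCartierLinear.frobenius_comp_mem_diffOpRing hR (D.isCartierLinear_extend hc hρ)), ?_⟩
  change θ (D.extend (p ^ e) ρ (algebraMap T R t) ^ p ^ e) = 1
  rw [D.extend_algebraMap hρ, hρt, mul_one, hθc]

/-- If some differential operator sends a nonzerodivisor `d` to `1`, then the fraction `r / d` lies
in the ring as soon as it is idempotent. -/
theorem exists_isIdempotentElem_of_sq_eq_mul (hR : IsFFinite p R) {d r : R}
    (hd : ∀ x y : R, d * x = d * y → x = y) {θ : Module.End ℤ R} (hθ : θ ∈ diffOpRing ℤ R)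
    (hθd : θ d = 1) (hr : r * r = d * r) : ∃ f, IsIdempotentElem f ∧ r = d * f := by
  obtain ⟨e, he⟩ := (mem_diffOpRing_iff_of_isFFinite p hR).1 hθ
  have hdpow (n : ℕ) : ∀ x y : R, d ^ n * x = d ^ n * y → x = y := by
    induction n with
    | zero => simp
    | succ n ih => exact fun x y h => hd _ _ (ih _ _ (by rwa [← mul_assoc, ← mul_assoc, ← pow_succ]))
  have hrpow (n : ℕ) : r ^ (n + 1) = d ^ n * r := by
    induction n with
    | zero => simp
    | succ n ih => rw [pow_succ, ih, mul_assoc, hr, ← mul_assoc, ← pow_succ]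
  obtain ⟨q, hq⟩ : ∃ q, p ^ e = q + 1 :=
    ⟨p ^ e - 1, by have := pow_pos hp.out.pos e; omega⟩
  rw [hq] at he
  -- Apply θ to d^(p^e) r = r^(p^e) d, pulling out the p^e-th power on either side.
  have h1 : r = d * θ r := by
    refine hdpow q _ _ ?_
    rw [← mul_assoc, ← pow_succ, ← he, pow_succ, mul_assoc, ← hr, ← mul_assoc, ← hrpow,
      ← pow_succ]
    have : r ^ (q + 1 + 1) = r ^ (q + 1) * d := by
      rw [hrpow, hrpow, pow_succ]; ring
    rw [this, he, hθd, mul_one]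
  refine ⟨θ r, ?_, h1⟩
  refine hd _ _ (hd _ _ ?_)
  have h2 : (d * θ r) * (d * θ r) = d * (d * θ r) := by rw [← h1, hr]
  rw [← h2]
  ring

omit [IsRegularRing T] [CharP T p] in
/-- If the only idempotents of `R` are trivial and every nonzero element of `T` is sent to `1` by
some differential operator, then every nonzero element of `R` has a nonzero multiple in `T`. -/
theorem exists_mul_eq_algebraMap_of_forall_isIdempotentElem {A : Type w} [CommRing A]
    [Algebra R A] [IsLocalization (Algebra.algebraMapSubmonoid R (nonZeroDivisors T)) A]
    [IsReduced A] [IsArtinianRing A] (hR : IsFFinite p R)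
    (hd : ∀ t : T, t ≠ 0 → ∀ x y : R, t • x = t • y → x = y)
    (hT1 : ∀ t : T, t ≠ 0 → ∃ θ ∈ diffOpRing ℤ R, θ (algebraMap T R t) = 1)
    (hidem : ∀ e : R, IsIdempotentElem e → e = 0 ∨ e = 1) {x : R} (hx : x ≠ 0) :
    ∃ (s : R) (t : T), t ≠ 0 ∧ s * x = algebraMap T R t := by
  let ι := algebraMap R A
  have hle : Algebra.algebraMapSubmonoid R (nonZeroDivisors T) ≤ nonZeroDivisors R := by
    rintro _ ⟨t, ht, rfl⟩
    rw [mem_nonZeroDivisors_iff_right]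
    intro y hy
    refine hd t (nonZeroDivisors.ne_zero ht) _ _ ?_
    rw [smul_zero, Algebra.smul_def, mul_comm]
    exact hy
  have hinj : Function.Injective ι := IsLocalization.injective _ hle
  have hsurj (z : A) : ∃ (r : R) (t : T), t ≠ 0 ∧ z * ι (algebraMap T R t) = ι r := by
    obtain ⟨⟨r, ⟨_, t, ht, rfl⟩⟩, h⟩ :=
      IsLocalization.surj (Algebra.algebraMapSubmonoid R (nonZeroDivisors T)) z
    exact ⟨r, t, nonZeroDivisors.ne_zero ht, h⟩
  have hunit (t : T) (ht : t ≠ 0) : IsUnit (ι (algebraMap T R t)) :=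
    IsLocalization.map_units A
      (⟨_, t, mem_nonZeroDivisors_of_ne_zero ht, rfl⟩ :
        Algebra.algebraMapSubmonoid R (nonZeroDivisors T))
  -- Stabilization gives xⁿ = xⁿ⁺¹y; reducedness improves it to x = x²y, so xy is idempotent.
  obtain ⟨n, y, hy⟩ := IsArtinian.exists_pow_succ_smul_dvd (ι x) (1 : A)
  have hy1 : ι x * (1 - ι x * y) = 0 := by
    refine pow_eq_zero_iff (n + 1).succ_ne_zero |>.1 ?_
    simp only [smul_eq_mul, mul_one, Nat.succ_eq_add_one] at hy
    have h1 : ι x ^ n * (1 - ι x * y) = 0 := by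
      rw [mul_sub, mul_one, ← mul_assoc, ← pow_succ, hy, sub_self]
    calc (ι x * (1 - ι x * y)) ^ (n + 1).succ =
        (ι x ^ n * (1 - ι x * y)) * (ι x ^ 2 * (1 - ι x * y) ^ (n + 1)) := by
          rw [Nat.succ_eq_add_one, mul_pow]; ring
      _ = 0 := by rw [h1, zero_mul]
  have hxy : ι x = ι x * (ι x * y) := by
    rw [mul_sub, mul_one, sub_eq_zero] at hy1; exact hy1
  have hff : (ι x * y) * (ι x * y) = ι x * y := by
    rw [← mul_assoc, mul_comm _ (ι x), ← hxy]
  obtain ⟨r, t, ht, hr⟩ := hsurj (ι x * y)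
  have hrr : r * r = algebraMap T R t * r := by
    apply hinj
    rw [map_mul, map_mul, ← hr, mul_mul_mul_comm, hff]
    ring
  obtain ⟨θ, hθ, hθt⟩ := hT1 t ht
  obtain ⟨f, hf, hrf⟩ := exists_isIdempotentElem_of_sq_eq_mul hR
    (by simpa only [Algebra.smul_def] using hd t ht) hθ hθt hrr
  have hf1 : ι x * y = ι f := by
    refine (hunit t ht).mul_right_cancel ?_
    rw [hr, hrf, map_mul, mul_comm]
  -- The value 0 would force x = 0; the value 1 makes y an inverse of x, and clearing its
  -- denominator gives the multiple.
  rcases hidem f hf with rfl | rfl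
  · refine absurd (hinj ?_) hx
    rw [map_zero]
    rw [hxy, hf1, map_zero, mul_zero]
  · obtain ⟨s, u, hu, hs⟩ := hsurj y
    refine ⟨s, u, hu, hinj ?_⟩
    rw [map_mul, ← hs, mul_right_comm, mul_comm y, hf1, map_one, one_mul]

theorem isSimpleModule_diffOpRing_of_forall_mul_mem [Nontrivial R]
    (h : ∀ x : R, x ≠ 0 → ∃ s : R, ∃ θ ∈ diffOpRing ℤ R, θ (s * x) = 1) :
    IsSimpleModule (diffOpRing ℤ R) R := by
  refine isSimpleModule_iff_toSpanSingleton_surjective.2 ⟨inferInstance, fun x hx y => ?_⟩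
  obtain ⟨s, θ, hθ, hθx⟩ := h x hx
  refine ⟨⟨LinearMap.mulLeft ℤ y * (θ * LinearMap.mulLeft ℤ s),
    mul_mem (mulLeft_mem_diffOpRing y) (mul_mem hθ (mulLeft_mem_diffOpRing s))⟩, ?_⟩
  change y * θ (s * x) = y
  rw [hθx, mul_one]

theorem exists_mem_diffOpRing_eq_one_of_isSimpleModule
    (h : IsSimpleModule (diffOpRing ℤ R) R) {x : R} (hx : x ≠ 0) :
    ∃ θ ∈ diffOpRing ℤ R, θ x = 1 := by
  obtain ⟨θ, hθ⟩ := (isSimpleModule_iff_toSpanSingleton_surjective.1 h).2 x hx 1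
  exact ⟨θ.1, θ.2, hθ⟩

omit [IsRegularRing T] in
/-- Injectivity of multiplication by nonzero scalars. -/
theorem smul_left_cancel_of_isTorsionFree [Module.IsTorsionFree T R] {t : T} (ht : t ≠ 0)
    {x y : R} (h : t • x = t • y) : x = y :=
  smul_right_injective R ht h

variable {K : Type w} [Field K] [Algebra T K] [IsFractionRing T K]

omit [IsRegularRing T] in
theorem includeRight_injective_of_isTorsionFree [Module.IsTorsionFree T R] :
    Function.Injective (Algebra.TensorProduct.includeRight : R →ₐ[T] K ⊗[T] R) := by
  let := Algebra.TensorProduct.rightAlgebra (R := T) (A := K) (B := R)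
  refine IsLocalization.injective (K ⊗[T] R)
    (M := Algebra.algebraMapSubmonoid R (nonZeroDivisors T)) ?_
  rintro _ ⟨t, ht, rfl⟩
  rw [mem_nonZeroDivisors_iff_right]
  intro y hy
  refine smul_left_cancel_of_isTorsionFree (nonZeroDivisors.ne_zero ht) ?_
  rw [smul_zero, Algebra.smul_def, mul_comm]
  exact hy

omit [IsDomain T] [IsRegularRing T] [IsFractionRing T K] in
theorem IsDiscriminant.ne_zero [Module.Finite T R] [Algebra.Smooth K (K ⊗[T] R)] {c : T}
    (hc : IsDiscriminant T R K c) : c ≠ 0 := by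
  obtain ⟨n, r, b, hb, hdet⟩ := hc
  rintro rfl
  refine (Algebra.Smooth.exists_algHom_trace_eq_sum_and_discr_ne_zero K (K ⊗[T] R)).2 b ?_
  rw [map_zero] at hdet
  rw [Algebra.discr_def, hdet]
  congr 1
  ext i j
  rw [Algebra.traceMatrix_apply, Algebra.traceForm_apply, hb, hb,
    Algebra.TensorProduct.tmul_mul_tmul, one_mul, Matrix.of_apply]

omit [IsRegularRing T] [IsFractionRing T K] in
theorem exists_mem_diffOpRing_discriminant_sq_of_isSimpleModule [Module.Finite T R]
    [Module.IsTorsionFree T R] [Nontrivial R] [Algebra.Smooth K (K ⊗[T] R)]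
    {c : T} (hc : IsDiscriminant T R K c) (h : IsSimpleModule (diffOpRing ℤ R) R) :
    ∃ θ ∈ diffOpRing ℤ R, θ (algebraMap T R c ^ 2) = 1 := by
  refine exists_mem_diffOpRing_eq_one_of_isSimpleModule h ?_
  rw [← map_pow, Algebra.algebraMap_eq_smul_one]
  exact smul_ne_zero (pow_ne_zero 2 hc.ne_zero) one_ne_zero

theorem isSimpleModule_of_exists_mem_diffOpRing_discriminant_sq [Module.Finite T R]
    [Module.IsTorsionFree T R] [Algebra.Smooth K (K ⊗[T] R)]
    (hT : IsFFinite p T) (hR : IsFFinite p R) {c : T} (hc : IsDiscriminant T R K c)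
    (hidem : ∀ e : R, IsIdempotentElem e → e = 0 ∨ e = 1)
    (h : ∃ θ ∈ diffOpRing ℤ R, θ (algebraMap T R c ^ 2) = 1) :
    IsSimpleModule (diffOpRing ℤ R) R := by
  have : Nontrivial R := CharP.nontrivial_of_char_ne_one hp.out.ne_one
  have : IsIntegrallyClosed T := isIntegrallyClosed_of_isRegularRing_of_isFFinite p hT
  obtain ⟨D⟩ := hc.nonempty_traceDual (p := p) includeRight_injective_of_isTorsionFree
  have hT1 (t : T) (ht : t ≠ 0) := exists_mem_diffOpRing_algebraMap_eq_one hT hR D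
    (fun _ _ => smul_left_cancel_of_isTorsionFree hc.ne_zero) h ht
  have : IsReduced (K ⊗[T] R) := Algebra.Smooth.isReduced_of_field K _
  have : IsArtinianRing (K ⊗[T] R) := IsArtinianRing.of_finite K _
  let := Algebra.TensorProduct.rightAlgebra (R := T) (A := K) (B := R)
  refine isSimpleModule_diffOpRing_of_forall_mul_mem fun x hx => ?_
  obtain ⟨s, t, ht, hst⟩ := exists_mul_eq_algebraMap_of_forall_isIdempotentElem (A := K ⊗[T] R) hR
    (fun t ht _ _ => smul_left_cancel_of_isTorsionFree ht) hT1 hidem hx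
  exact ⟨s, hst ▸ hT1 t ht⟩

omit [IsRegularRing T] in
/-- A finite extension of domains with separable extension of fraction fields is generically
smooth. -/
theorem smooth_tensorProduct_of_isSeparable [Module.Finite T R] [Module.IsTorsionFree T R]
    (L : Type*) [Field L] [Algebra R L]
    [Algebra T L] [Algebra K L] [IsScalarTower T R L] [IsScalarTower T K L] [IsDomain R]
    [IsFractionRing R L] [Algebra.IsSeparable K L] : Algebra.Smooth K (K ⊗[T] R) := by
  let φ : K ⊗[T] R →ₐ[K] L :=
    Algebra.TensorProduct.lift (Algebra.ofId K L) (IsScalarTower.toAlgHom T R L)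
      fun _ _ => Commute.all _ _
  have hφ (a : K) (r : R) : φ (a ⊗ₜ r) = algebraMap K L a * algebraMap R L r := by
    simp [φ, Algebra.ofId_apply]
  have hinj : Function.Injective φ := by
    rw [injective_iff_map_eq_zero]
    intro z hz
    let := Algebra.TensorProduct.rightAlgebra (R := T) (A := K) (B := R)
    obtain ⟨⟨r, m⟩, h⟩ := IsLocalization.surj
      (Algebra.algebraMapSubmonoid R (nonZeroDivisors T)) z
    have h0 : z * algebraMap R (K ⊗[T] R) m = (1 : K) ⊗ₜ r := h
    have h1 := congrArg φ h0
    rw [map_mul, hz, zero_mul, hφ, map_one, one_mul] at h1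
    have hr : r = 0 := IsFractionRing.injective R L (by rw [← h1, map_zero])
    rw [hr, TensorProduct.tmul_zero] at h0
    exact (IsLocalization.map_units (K ⊗[T] R) m).mul_left_eq_zero.1 h0
  have : IsDomain (K ⊗[T] R) := hinj.isDomain φ.toRingHom
  -- A domain integral over a field is a field, so it already contains all fractions of R and fills
  -- L.
  have hfield : IsField (K ⊗[T] R) :=
    isField_of_isIntegral_of_isField' (R := K) (Field.toIsField K)
  have hsurj : Function.Surjective φ := by
    intro l
    obtain ⟨a, b, hb, rfl⟩ := IsFractionRing.div_surjective (A := R) l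
    have hb0 : (1 : K) ⊗ₜ[T] b ≠ 0 := fun h => nonZeroDivisors.ne_zero hb
      (includeRight_injective_of_isTorsionFree (T := T) (K := K) (by rw [map_zero]; exact h))
    obtain ⟨y, hy⟩ := hfield.mul_inv_cancel hb0
    refine ⟨(1 ⊗ₜ a) * y, ?_⟩
    have hy' := congrArg φ hy
    rw [map_mul, hφ, map_one, map_one, one_mul] at hy'
    rw [map_mul, hφ, map_one, one_mul, eq_div_iff (left_ne_zero_of_mul_eq_one hy'), mul_assoc,
      mul_comm (φ y), hy', mul_one]
  have E := (AlgEquiv.ofBijective φ ⟨hinj, hsurj⟩).symm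
  have := Algebra.FormallyEtale.of_isSeparable K L
  have : Module.Finite K L := Module.Finite.equiv E.symm.toLinearEquiv
  have : Algebra.FinitePresentation K L :=
    Algebra.FinitePresentation.of_finiteType.1 inferInstance
  have : Algebra.Smooth K L := ⟨inferInstance, inferInstance⟩
  exact Algebra.Smooth.of_equiv E

end Simplicity

theorem mainTheorem3 (p : ℕ) [Fact p.Prime]
    (T R K : Type*) [CommRing T] [CommRing R] [Field K]
    [CharP T p] [CharP R p]
    [IsDomain T] [IsRegularRing T] [Algebra T K] [IsFractionRing T K]
    [Algebra T R] [Module.Finite T R]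
    (hTR : Function.Injective (algebraMap T R))
    (hT : IsFFinite p T) (hR : IsFFinite p R)
    (c : T) (hc : IsDiscriminant T R K c) :
    (∀ (L : Type*) [Field L] [Algebra R L] [Algebra T L] [Algebra K L]
        [IsScalarTower T R L] [IsScalarTower T K L],
      IsDomain R → IsFractionRing R L → Algebra.IsSeparable K L →
      (IsSimpleModule (diffOpRing ℤ R) R ↔
        ∃ θ ∈ diffOpRing ℤ R, θ (algebraMap T R c ^ 2) = 1)) ∧
    (IsReduced R → Module.IsTorsionFree T R → Algebra.Smooth K (K ⊗[T] R) →
      (IsSimpleModule (diffOpRing ℤ R) R →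
        ∃ θ ∈ diffOpRing ℤ R, θ (algebraMap T R c ^ 2) = 1) ∧
      ((∀ e : R, IsIdempotentElem e → e = 0 ∨ e = 1) →
        (∃ θ ∈ diffOpRing ℤ R, θ (algebraMap T R c ^ 2) = 1) →
        IsSimpleModule (diffOpRing ℤ R) R)) := by

  have : Nontrivial R := CharP.nontrivial_of_char_ne_one (Fact.out : p.Prime).ne_one
  refine ⟨fun L _ _ _ _ _ _ hdom hfrac hsep => ?_, fun _ htf hsm => ?_⟩
  · have : Module.IsTorsionFree T R := by
      have : FaithfulSMul T R := (faithfulSMul_iff_algebraMap_injective T R).2 hTR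
      infer_instance
    have : Algebra.Smooth K (K ⊗[T] R) := smooth_tensorProduct_of_isSeparable L
    exact ⟨exists_mem_diffOpRing_discriminant_sq_of_isSimpleModule hc,
      isSimpleModule_of_exists_mem_diffOpRing_discriminant_sq hT hR hc
        fun e he => IsIdempotentElem.iff_eq_zero_or_one.1 he⟩
  · exact ⟨exists_mem_diffOpRing_discriminant_sq_of_isSimpleModule hc,
      isSimpleModule_of_exists_mem_diffOpRing_discriminant_sq hT hR hc⟩
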